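/- Fix $r\ge 1$. An $r$-digraph is an $r$-uniform fully directed hypergraph: each edge is an ordered list of $r$ distinct vertices. An $(r,k)$-tournament is an $r$-digraph in which, for every $r$-set $A$ of vertices, exactly $k$ of the $r!$ orderings of $A$ are edges. The tight path on $s$ vertices is the $r$-digraph on an ordered list of $s$ vertices whose edges are its intervals of $r$ consecutive vertices. An $r$-digraph $G$ contains a tight path if some injection of the vertices of the path into those of $G$ maps edges to edges. For $0\le k\le r!$ let $f(n,r,k)$ be the maximum $s$ such that every $n$-vertex $(r,k)$-tournament contains the tight path on $s$ vertices. The threshold for growing paths in $r$-uniform tournaments is the minimum $k$ such that $f(n,r,k)\to\infty$ as $n\to\infty$. The pattern-shift graph $\mathrm{PSG}_r$ is the digraph (loops allowed) whose vertices are the permutations $(a_1,\ldots,a_r)$ of $\{1,\ldots,r\}$, with an edge from $a$ to $b$ if and only if the lists $(a_2,\ldots,a_r)$ and $(b_1,\ldots,b_{r-1})$ are order isomorphic, that is, $a_{i+1}<a_{j+1}\iff b_i<b_j$ for all $1\le i<j\le r-1$. For a finite digraph $G$, let $a(G)$ be the maximum size of a set of vertices of $G$ inducing a subgraph without directed cycles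 (a loop counts as a cycle). Let $\varphi$ be the Euler totient function. Statement. There is an absolute constant $C>0$ such that for every integer $r\ge 3$, $$1-\frac1r-C\,\frac{\log r}{r^2\log\log r}\;\le\;\frac{a(\mathrm{PSG}_r)}{r!}\;\le\;1-\frac1r-\frac{\varphi(r)}{r!},$$ and the threshold for growing paths in $r$-uniform tournaments exists and lies in the interval $$\left[\left(1-\frac1r-C\,\frac{\log r}{r^2\log\log r}\right)r!,\;\left(1-\frac1r-\frac{\varphi(r)-1}{r!}\right)r!\right].$$ -/

import Mathlib

open Filter
open scoped Nat

namespace GrowingPaths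

/-- Two lists of the same length pattern-match (are order isomorphic). -/
def PatternMatch {s : ℕ} {α β : Type*} [LT α] [LT β] (a : Fin s → α) (b : Fin s → β) : Prop :=
  ∀ i j : Fin s, i < j → (a i < a j ↔ b i < b j)

/-- The list of the last `r - 1` entries of a list of length `r`. -/
def suffix {r : ℕ} {α : Type*} (a : Fin r → α) : Fin (r - 1) → α :=
  fun i => a ⟨i.1 + 1, by omega⟩

/-- The list of the first `r - 1` entries of a list of length `r`. -/
def initial {r : ℕ} {α : Type*} (a : Fin r → α) : Fin (r - 1) → α :=
  fun i => a ⟨i.1, by omega⟩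

/-- The pattern-shift graph: there is an edge from `a` to `b` (possibly a loop) iff the
`(r-1)`-suffix of `a` pattern-matches the `(r-1)`-prefix of `b`. -/
def PSG (r : ℕ) : Digraph (Equiv.Perm (Fin r)) where
  Adj a b := PatternMatch (suffix a) (initial b)

/-- `v 0, …, v m` is a directed cycle of `G` with `m + 1` distinct vertices. The addition
in `Fin (m + 1)` is cyclic, so a loop is a cycle with one vertex. -/
def IsDirectedCycle {V : Type*} (G : Digraph V) {m : ℕ} (v : Fin (m + 1) → V) : Prop :=
  Function.Injective v ∧ ∀ i, G.Adj (v i) (v (i + 1))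

/-- The subgraph of `G` induced by `S` has no directed cycle. -/
def InducesAcyclic {V : Type*} (G : Digraph V) (S : Finset V) : Prop :=
  ∀ (m : ℕ) (v : Fin (m + 1) → V), IsDirectedCycle G v → ¬ ∀ i, v i ∈ S

/-- `a(G)`: the maximum size of a set of vertices of the finite digraph `G` that induces an
acyclic subgraph. -/
noncomputable def acyclicNumber {V : Type*} [Fintype V] (G : Digraph V) : ℕ :=
  sSup {n : ℕ | ∃ S : Finset V, InducesAcyclic G S ∧ S.card = n}

/-- An `r`-uniform fully directed hypergraph: edges are lists of `r` distinct vertices. -/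
structure RDigraph (r : ℕ) (V : Type*) where
  edges : Set (Fin r ↪ V)

/-- `F` is a subgraph of `G`: some injection of the vertices maps edges to edges. -/
def RDigraph.IsSubgraphOf {r : ℕ} {V W : Type*} (F : RDigraph r V) (G : RDigraph r W) : Prop :=
  ∃ h : V ↪ W, ∀ e ∈ F.edges, e.trans h ∈ G.edges

/-- `G` is an `(r,k)`-tournament: exactly `k` of the orderings of each `r`-set of vertices
are edges. -/
def RDigraph.IsTournament {r : ℕ} {V : Type*} (k : ℕ) (G : RDigraph r V) : Prop :=
  ∀ A : Finset V, A.card = r →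
    {e : Fin r ↪ V | e ∈ G.edges ∧ Set.range e = (A : Set V)}.ncard = k

/-- The directed tight path on `s` vertices: the edges are the intervals of size `r`. -/
def tightPath (r s : ℕ) : RDigraph r (Fin s) where
  edges := {e | ∃ j : ℕ, ∀ i : Fin r, (e i : ℕ) = j + i}

/-- `f(n,r,k)`: the maximum `s` such that every `n`-vertex `(r,k)`-tournament contains the
tight path on `s` vertices. For `k ≤ r!` tournaments exist and the maximum is over a set that
contains `0` and is bounded by `n`. -/
noncomputable def pathNumber (n r k : ℕ) : ℕ :=
  sSup {s : ℕ | ∀ G : RDigraph r (Fin n), G.IsTournament k → (tightPath r s).IsSubgraphOf G}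

/-- `k` is the threshold for growing paths in `r`-uniform tournaments: the minimum `k ≤ r!`
with `f(n,r,k) → ∞` as `n → ∞`. -/
def IsGrowingPathThreshold (r k : ℕ) : Prop :=
  IsLeast {k : ℕ | k ≤ r ! ∧ Tendsto (fun n => pathNumber n r k) atTop atTop} k

end GrowingPaths

/-!
A walk in the pattern-shift graph is the same as a sequence of distinct rationals, read through
the patterns of its windows of length `r` (`exists_realization`).

*Upper bound on the acyclic number.* The rotation classes of permutations are `(r - 1)!` disjoint
directed cycles, and every one of them has to lose a vertex. For a unit `d` modulo `r` the class of
`i ↦ d * i` has two members with order isomorphic suffixes (`unitPerm_adj_iff`). They have the same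
out-neighbours, so the class splits into two directed cycles and has to lose two vertices. This
gives `φ(r)` additional vertices (`factorial_add_totient_le_card_compl`).

*Lower bound.* Assign to every window of `S = 2 * m` consecutive terms of a sequence a letter in
`ℕ`, depending only on the pattern of the window, and let `F = leadingMax` be the set of patterns
whose first letter is at least as large as all letters that fit into the pattern. Along a directed
cycle a pattern with the largest first letter is in `F`, so the complement of `F` is acyclic
(`inducesAcyclic_compl_leadingMax`). It remains to see that `F` has density `1 / r + O(1 / r ^ 2)`,
which is more than is needed, since `log r / log log r ≥ 1`. The letter is zero unless the window is
marked: a condition of probability about `S ^ (-4)` chosen so that overlapping windows are both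
marked with only exponentially small probability in `m`; the letter of a marked window records `m`
independent comparisons. If two different rotations of a permutation are in `F` with positive first
letters, then the two first windows overlap, or they see each other and have equal letters. Both
are improbable (`card_pair_mul_le`), so typically at most one of the `r` rotations is in `F`, which
gives the density `1 / r` (`card_markedLeadingMax_le`). The patterns without marked windows are
rare, as `r / S` disjoint windows would have to be unmarked (`card_unmarked_le`). The window length
is a multiple of `log r`. All probabilities are bounded by rearranging the entries in disjoint
blocks (`card_filter_mul_pow_le`).

*The threshold* is one more than the acyclic number (`isGrowingPathThreshold`). If `T` is an acyclic
set of patterns, then the lists with pattern in `T` form a tournament in which the windows of a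
tight path are a walk within `T`, so tight paths are short. If `k` exceeds the acyclic number, then
Ramsey's theorem gives a large set of vertices in which all `r`-sets have the same `k` edge
patterns. These contain a directed cycle, and going around it produces a long tight path
(`isSubgraphOf_of_homogeneous`).
-/

namespace GrowingPaths

section Rotations

open scoped Fin.CommRing Fin.NatCast

/-! ### Pattern matching and the edges of the pattern-shift graph -/

lemma PatternMatch.lt_iff_lt {s : ℕ} {α β : Type*} [LinearOrder α] [LinearOrder β]
    {a : Fin s → α} {b : Fin s → β} (h : PatternMatch a b) (ha : Function.Injective a)
    (hb : Function.Injective b) (i j : Fin s) : a i < a j ↔ b i < b j := by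
  rcases lt_trichotomy i j with hij | rfl | hij
  · exact h i j hij
  · simp
  · have h1 := h j i hij
    have h2 : a i ≠ a j := fun h => hij.ne' (ha h)
    have h3 : b i ≠ b j := fun h => hij.ne' (hb h)
    rw [← not_iff_not, not_lt, not_lt, le_iff_lt_or_eq, le_iff_lt_or_eq, h1]
    simp [h2.symm, h3.symm]

lemma suffix_injective {r : ℕ} {α : Type*} {a : Fin r → α} (ha : Function.Injective a) :
    Function.Injective (suffix a) := by
  intro i j h
  have := ha h
  simp only [Fin.mk.injEq] at this
  exact Fin.ext (by omega)

lemma initial_injective {r : ℕ} {α : Type*} {a : Fin r → α} (ha : Function.Injective a) :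
    Function.Injective (initial a) := by
  intro i j h
  have := ha h
  simp only [Fin.mk.injEq] at this
  exact Fin.ext (by omega)

lemma lt_iff_lt_of_adj {r : ℕ} {a b : Equiv.Perm (Fin r)} (h : (PSG r).Adj a b) {i j : ℕ}
    (hi : i + 1 < r) (hj : j + 1 < r) :
    a ⟨i + 1, hi⟩ < a ⟨j + 1, hj⟩ ↔ b ⟨i, by omega⟩ < b ⟨j, by omega⟩ :=
  PatternMatch.lt_iff_lt (a := suffix a) (b := initial b) h (suffix_injective a.injective)
    (initial_injective b.injective) ⟨i, by omega⟩ ⟨j, by omega⟩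

/-- A permutation is determined by its pattern. -/
lemma perm_eq_of_lt_iff_lt {r : ℕ} {a b : Equiv.Perm (Fin r)}
    (h : ∀ i j, a i < a j ↔ b i < b j) : a = b := by
  have hm : StrictMono (b * a⁻¹) := by
    intro i j hij
    have := (h (a⁻¹ i) (a⁻¹ j)).1 (by simpa using hij)
    simpa using this
  have h1 : b * a⁻¹ = 1 := by
    have h2 : (hm.orderIsoOfSurjective _ (b * a⁻¹).surjective) = OrderIso.refl _ :=
      Subsingleton.elim _ _
    ext i
    have := congrArg (fun f => (f i : ℕ)) h2
    simpa using this
  exact (mul_inv_eq_one.1 h1).symm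

/-! ### Rotations and disjoint cycles -/

/-- Rotating a permutation one step to the left is an edge of the pattern-shift graph. -/
lemma adj_rotate {n : ℕ} (a : Equiv.Perm (Fin (n + 1))) (c : Fin (n + 1)) :
    (PSG (n + 1)).Adj (a * Equiv.addRight c) (a * Equiv.addRight (c + 1)) := by
  have key : ∀ (i : ℕ) (hi : i < n),
      (⟨i + 1, by omega⟩ : Fin (n + 1)) = ⟨i, by omega⟩ + 1 := by
    intro i hi
    rw [Fin.ext_iff, Fin.val_add_one_of_lt]
    simpa [Fin.lt_def] using hi
  intro i j _
  have hi := key i.1 (by have := i.2; omega)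
  have hj := key j.1 (by have := j.2; omega)
  simp only [suffix, initial, Equiv.Perm.mul_apply, Equiv.coe_addRight, hi, hj]
  rw [add_right_comm, add_right_comm _ 1 c, add_assoc, add_assoc]

lemma isDirectedCycle_arc {n : ℕ} (a : Equiv.Perm (Fin (n + 1))) (s m : ℕ) (hm : m ≤ n)
    (hclose : (PSG (n + 1)).Adj (a * Equiv.addRight ((s + m : ℕ) : Fin (n + 1)))
      (a * Equiv.addRight (s : Fin (n + 1)))) :
    IsDirectedCycle (PSG (n + 1))
      (fun i : Fin (m + 1) => a * Equiv.addRight ((s + i.1 : ℕ) : Fin (n + 1))) := by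
  refine ⟨?_, ?_⟩
  · intro i j hij
    have h1 := congrArg (fun f : Equiv.Perm (Fin (n + 1)) => f 0) hij
    simp only [Equiv.Perm.mul_apply, Equiv.coe_addRight, zero_add] at h1
    have h2 := a.injective h1
    push_cast at h2
    have h3 := congrArg Fin.val (add_left_cancel h2)
    rw [Fin.val_natCast, Fin.val_natCast, Nat.mod_eq_of_lt (by omega),
      Nat.mod_eq_of_lt (by omega)] at h3
    exact Fin.ext h3
  · intro i
    induction i using Fin.lastCases with
    | last => simpa using hclose
    | cast i =>
      have := adj_rotate a ((s + i.1 : ℕ) : Fin (n + 1))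
      simpa [Fin.val_add_one_of_lt (Fin.castSucc_lt_last i), add_assoc] using this

/-- The permutation `i ↦ d * i` of `ℤ / (n + 1)ℤ`, for a unit `d`. -/
def unitPerm {n : ℕ} (d : (Fin (n + 1))ˣ) : Equiv.Perm (Fin (n + 1)) :=
  Units.mulLeft d

lemma sub_one_lt_sub_one_iff {n : ℕ} {x y : Fin (n + 1)} (hx : x ≠ 0) (hy : y ≠ 0) :
    x - 1 < y - 1 ↔ x < y := by
  rw [Fin.lt_def, Fin.lt_def, Fin.val_sub_one_of_ne_zero hx, Fin.val_sub_one_of_ne_zero hy]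
  have := Fin.pos_iff_ne_zero.2 hx
  have := Fin.pos_iff_ne_zero.2 hy
  rw [Fin.lt_def] at *
  simp at *
  omega

/-- The two rotations of `unitPerm d` that start with the largest and with the smallest value
have order isomorphic suffixes: the suffixes differ by the shift `z ↦ z - 1`, applied to
non-zero residues. Hence these two rotations have the same out-neighbours. -/
lemma unitPerm_adj_iff {n : ℕ} (d : (Fin (n + 1))ˣ) (k : Fin (n + 1))
    (hk : unitPerm d k = -1) (b : Equiv.Perm (Fin (n + 1))) :
    (PSG (n + 1)).Adj (unitPerm d * Equiv.addRight k) b ↔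
      (PSG (n + 1)).Adj (unitPerm d * Equiv.addRight (0 : Fin (n + 1))) b := by
  have hval : ∀ i : Fin (n + 1), unitPerm d (i + k) = unitPerm d i - 1 := by
    intro i
    have : unitPerm d (i + k) = unitPerm d i + unitPerm d k :=
      mul_add (d : Fin (n + 1)) i k
    rw [this, hk, sub_eq_add_neg]
  have h0 : unitPerm d 0 = 0 := mul_zero (d : Fin (n + 1))
  have hne : ∀ i : Fin (n + 1), i ≠ 0 → unitPerm d i ≠ 0 := by
    intro i hi h
    exact hi ((unitPerm d).injective (h.trans h0.symm))
  have hs : ∀ i j : Fin (n + 1 - 1), suffix (unitPerm d * Equiv.addRight k) i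
      < suffix (unitPerm d * Equiv.addRight k) j ↔
        suffix (unitPerm d * Equiv.addRight (0 : Fin (n + 1))) i
      < suffix (unitPerm d * Equiv.addRight (0 : Fin (n + 1))) j := by
    intro i j
    simp only [suffix, Equiv.Perm.mul_apply, Equiv.coe_addRight, add_zero, hval]
    exact sub_one_lt_sub_one_iff (hne _ (by simp [Fin.ext_iff])) (hne _ (by simp [Fin.ext_iff]))
  exact forall_congr' fun i => forall_congr' fun j => imp_congr_right fun _ => by rw [hs]

/-! ### The upper bound on the acyclic number -/

lemma InducesAcyclic.exists_arc_notMem {n : ℕ} {T : Finset (Equiv.Perm (Fin (n + 1)))}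
    (hT : InducesAcyclic (PSG (n + 1)) T) (a : Equiv.Perm (Fin (n + 1))) (s m : ℕ) (hm : m ≤ n)
    (hclose : (PSG (n + 1)).Adj (a * Equiv.addRight ((s + m : ℕ) : Fin (n + 1)))
      (a * Equiv.addRight (s : Fin (n + 1)))) :
    ∃ i, s ≤ i ∧ i ≤ s + m ∧ a * Equiv.addRight ((i : ℕ) : Fin (n + 1)) ∉ T := by
  have := hT m _ (isDirectedCycle_arc a s m hm hclose)
  push Not at this
  obtain ⟨i, hi⟩ := this
  exact ⟨s + i, by omega, by omega, hi⟩

/-- The rotation of `b` that starts with the value `0`, a canonical representative of its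
rotation class. -/
def rotateToZero {n : ℕ} (b : Equiv.Perm (Fin (n + 1))) : Equiv.Perm (Fin (n + 1)) :=
  b * Equiv.addRight (b⁻¹ 0)

lemma rotateToZero_mul_addRight {n : ℕ} {a : Equiv.Perm (Fin (n + 1))} (ha : a 0 = 0)
    (c : Fin (n + 1)) : rotateToZero (a * Equiv.addRight c) = a := by
  have h : (a * Equiv.addRight c)⁻¹ 0 = -c := by
    rw [Equiv.Perm.inv_eq_iff_eq]
    simp [ha]
  rw [rotateToZero, h]
  ext i
  simp

lemma card_perm_fix_zero (n : ℕ) :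
    (Finset.univ.filter fun a : Equiv.Perm (Fin (n + 1)) => a 0 = 0).card = n ! := by
  have h : (Finset.univ.filter fun a : Equiv.Perm (Fin (n + 1)) => a 0 = 0)
      = Finset.univ.image fun p : Equiv.Perm (Fin n) => Equiv.Perm.decomposeFin.symm (0, p) := by
    ext a
    simp only [Finset.mem_filter, Finset.mem_univ, true_and, Finset.mem_image]
    constructor
    · intro ha
      obtain ⟨⟨p, q⟩, rfl⟩ := Equiv.Perm.decomposeFin.symm.surjective a
      have hp : p = 0 := by simpa using ha
      exact ⟨q, by rw [hp]⟩
    · rintro ⟨p, rfl⟩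
      simp
  rw [h, Finset.card_image_of_injective _ fun p q h => by simpa using h, Finset.card_univ,
    Fintype.card_perm, Fintype.card_fin]

/-- Every rotation class meets the complement of an acyclic set, and the `φ(r)` classes of the
permutations `unitPerm d` meet it twice, as each of them splits into two directed cycles. -/
theorem factorial_add_totient_le_card_compl {n : ℕ} (hn : 1 ≤ n)
    {T : Finset (Equiv.Perm (Fin (n + 1)))} (hT : InducesAcyclic (PSG (n + 1)) T) :
    n ! + Nat.totient (n + 1) ≤ Tᶜ.card := by
  classical
  set Z := Finset.univ.filter fun a : Equiv.Perm (Fin (n + 1)) => a 0 = 0 with hZ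
  have hZmem : ∀ a, a ∈ Z ↔ a 0 = 0 := by simp [hZ]
  set D : Finset (Equiv.Perm (Fin (n + 1))) := Finset.univ.image unitPerm with hD
  have hDZ : D ⊆ Z := by
    intro a ha
    obtain ⟨d, -, rfl⟩ := Finset.mem_image.1 ha
    exact (hZmem _).2 (mul_zero (d : Fin (n + 1)))
  have hDcard : D.card = Nat.totient (n + 1) := by
    rw [hD, Finset.card_image_of_injective, Finset.card_univ]
    · exact ZMod.card_units_eq_totient (n + 1)
    intro d e h
    have h1 := congrArg (fun f : Equiv.Perm (Fin (n + 1)) => f 1) h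
    have h2 : (d : Fin (n + 1)) * 1 = e * 1 := h1
    exact Units.ext (by simpa using h2)
  have hmaps : ∀ b ∈ Tᶜ, rotateToZero b ∈ Z := by
    intro b _
    rw [hZmem]
    simp [rotateToZero]
  rw [Finset.card_eq_sum_card_fiberwise hmaps]
  have hbound : ∀ a ∈ Z, 1 + (if a ∈ D then 1 else 0)
      ≤ (Tᶜ.filter fun b => rotateToZero b = a).card := by
    intro a ha
    have ha0 := (hZmem a).1 ha
    have hmem : ∀ i : ℕ, a * Equiv.addRight ((i : ℕ) : Fin (n + 1)) ∉ T →
        a * Equiv.addRight ((i : ℕ) : Fin (n + 1)) ∈ Tᶜ.filter fun b => rotateToZero b = a := by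
      intro i hi
      simp [hi, rotateToZero_mul_addRight ha0]
    split_ifs with h
    · obtain ⟨d, -, rfl⟩ := Finset.mem_image.1 h
      obtain ⟨k, hk⟩ := (unitPerm d).surjective (-1)
      have h0 : unitPerm d 0 = 0 := ha0
      have hk0 : k ≠ 0 := by
        rintro rfl
        rw [h0] at hk
        have h1 : ((0 : Fin (n + 1)) : ℕ) = ((-1 : Fin (n + 1)) : ℕ) := by rw [hk]
        rw [Fin.coe_neg_one] at h1
        simp at h1
        omega
      have hkpos : 0 < k.1 := Fin.pos_iff_ne_zero.2 hk0
      have hkn := k.2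
      have hkc : ((k.1 : ℕ) : Fin (n + 1)) = k := Fin.cast_val_eq_self k
      have hnc : ((n + 1 : ℕ) : Fin (n + 1)) = 0 := by simp
      obtain ⟨i, hi1, hi2, hi⟩ := hT.exists_arc_notMem (unitPerm d) 1 (k.1 - 1) (by omega) (by
        rw [show 1 + (k.1 - 1) = k.1 by omega, hkc, unitPerm_adj_iff d k hk]
        simpa using adj_rotate (unitPerm d) 0)
      obtain ⟨j, hj1, hj2, hj⟩ := hT.exists_arc_notMem (unitPerm d) (k.1 + 1) (n - k.1)
        (by omega) (by
          rw [show k.1 + 1 + (n - k.1) = n + 1 by omega, hnc, ← unitPerm_adj_iff d k hk]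
          simpa using adj_rotate (unitPerm d) k)
      refine Finset.one_lt_card.2 ⟨_, hmem i hi, _, hmem j hj, ?_⟩
      intro hij
      have h1 := congrArg (fun f : Equiv.Perm (Fin (n + 1)) => f 0) hij
      simp only [Equiv.Perm.mul_apply, Equiv.coe_addRight, zero_add] at h1
      have h2 := congrArg Fin.val ((unitPerm d).injective h1)
      rw [Fin.val_natCast, Fin.val_natCast, Nat.mod_eq_of_lt (by omega)] at h2
      rcases Nat.lt_or_ge j (n + 1) with hjn | hjn
      · rw [Nat.mod_eq_of_lt hjn] at h2
        omega
      · rw [show j = n + 1 by omega, Nat.mod_self] at h2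
        omega
    · obtain ⟨i, -, -, hi⟩ := hT.exists_arc_notMem a 0 n le_rfl (by
        have := adj_rotate a (Fin.last n)
        simpa using this)
      exact Finset.card_pos.2 ⟨_, hmem i hi⟩
  calc n ! + Nat.totient (n + 1) = ∑ a ∈ Z, (1 + (if a ∈ D then 1 else 0)) := by
        rw [Finset.sum_add_distrib, Finset.sum_ite_mem, Finset.inter_eq_right.2 hDZ]
        simp [hDcard, hZ, card_perm_fix_zero]
    _ ≤ _ := Finset.sum_le_sum hbound

lemma bddAbove_card_inducesAcyclic {V : Type*} [Fintype V] (G : Digraph V) :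
    BddAbove {n : ℕ | ∃ S : Finset V, InducesAcyclic G S ∧ S.card = n} := by
  refine ⟨Fintype.card V, ?_⟩
  rintro _ ⟨S, -, rfl⟩
  exact S.card_le_univ

lemma InducesAcyclic.card_le_acyclicNumber {V : Type*} [Fintype V] {G : Digraph V}
    {S : Finset V} (hS : InducesAcyclic G S) : S.card ≤ acyclicNumber G :=
  le_csSup (bddAbove_card_inducesAcyclic G) ⟨S, hS, rfl⟩

lemma exists_card_eq_acyclicNumber {V : Type*} [Fintype V] (G : Digraph V) :
    ∃ S : Finset V, InducesAcyclic G S ∧ S.card = acyclicNumber G :=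
  Nat.sSup_mem (s := {n : ℕ | ∃ S : Finset V, InducesAcyclic G S ∧ S.card = n})
    ⟨0, ∅, fun _ _ _ h => absurd (h 0) (Finset.notMem_empty _), rfl⟩
    (bddAbove_card_inducesAcyclic G)

theorem acyclicNumber_PSG_add_le {r : ℕ} (hr : 2 ≤ r) :
    acyclicNumber (PSG r) + (r - 1)! + Nat.totient r ≤ r ! := by
  obtain ⟨n, rfl⟩ : ∃ n, r = n + 1 := ⟨r - 1, by omega⟩
  obtain ⟨T, hT, hcard⟩ := exists_card_eq_acyclicNumber (PSG (n + 1))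
  have h1 := factorial_add_totient_le_card_compl (by omega) hT
  have h2 := Finset.card_add_card_compl T
  rw [Fintype.card_perm, Fintype.card_fin] at h2
  simp only [Nat.add_sub_cancel]
  omega

/-! ### Marked windows and letters -/

/-- The first `S` terms of `x` are marked: the three largest of them are `x 0`, `x 1` and
`x (S - 2)`, in this order, and the smallest is `x (S - 1)`. Two marked windows of the same
sequence cannot start at a distance in `[1, S - 3]`. -/
structure IsMarked {α : Type*} [LT α] (S : ℕ) (x : ℕ → α) : Prop where
  one_lt_zero : x 1 < x 0
  penultimate_lt_one : x (S - 2) < x 1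
  lt_penultimate : ∀ i, 2 ≤ i → i < S - 2 → x i < x (S - 2)
  last_lt : ∀ i, 2 ≤ i → i < S - 2 → x (S - 1) < x i

open scoped Classical in
/-- The letter of `x` is `0` if the first `2 * m` terms of `x` are not marked. Otherwise it is a
positive number that encodes the comparisons within the pairs `(x (2 * i), x (2 * i + 1))`,
`i < m`. -/
noncomputable def letter {α : Type*} [LT α] (m : ℕ) (x : ℕ → α) : ℕ :=
  if IsMarked (2 * m) x then
    Encodable.encode ((Finset.range m).filter fun i => x (2 * i) < x (2 * i + 1)) + 1
  else 0

section Marked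

variable {α : Type*} [Preorder α] {S : ℕ} {x : ℕ → α}

lemma IsMarked.lt_one (h : IsMarked S x) (hS : 5 ≤ S) {i : ℕ} (hi : 2 ≤ i) (hiS : i < S) :
    x i < x 1 := by
  rcases lt_trichotomy i (S - 2) with h1 | rfl | h1
  · exact (h.lt_penultimate i hi h1).trans h.penultimate_lt_one
  · exact h.penultimate_lt_one
  · obtain rfl : i = S - 1 := by omega
    exact ((h.last_lt 2 le_rfl (by omega)).trans
      (h.lt_penultimate 2 le_rfl (by omega))).trans h.penultimate_lt_one

lemma IsMarked.lt_zero (h : IsMarked S x) (hS : 5 ≤ S) {i : ℕ} (hi : 1 ≤ i) (hiS : i < S) :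
    x i < x 0 := by
  rcases hi.eq_or_lt with rfl | hi
  · exact h.one_lt_zero
  · exact (h.lt_one hS hi hiS).trans h.one_lt_zero

lemma IsMarked.last_lt' (h : IsMarked S x) (hS : 5 ≤ S) {i : ℕ} (hi : i < S - 1) :
    x (S - 1) < x i := by
  rcases Nat.lt_or_ge i 2 with h1 | h1
  · interval_cases i
    · exact h.lt_zero hS (by omega) (by omega)
    · exact h.lt_one hS (by omega) (by omega)
  · rcases Nat.lt_or_ge i (S - 2) with h2 | h2
    · exact h.last_lt i h1 h2
    · obtain rfl : i = S - 2 := by omega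
      exact (h.last_lt 2 le_rfl (by omega)).trans (h.lt_penultimate 2 le_rfl (by omega))

lemma IsMarked.not_isMarked_shift (h : IsMarked S x) (hS : 5 ≤ S) {j : ℕ} (hj : 1 ≤ j)
    (hjS : j ≤ S - 3) : ¬ IsMarked S fun i => x (j + i) := by
  intro h'
  rcases hj.eq_or_lt with rfl | hj
  · have h1 := h.lt_penultimate 2 le_rfl (by omega)
    have h2 := h'.lt_one hS (i := S - 3) (by omega) (by omega)
    rw [show 1 + (S - 3) = S - 2 by omega] at h2
    exact lt_asymm h1 h2
  · have h1 := h.lt_penultimate j hj (by omega)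
    have h2 := h'.lt_zero hS (i := S - 2 - j) (by omega) (by omega)
    rw [show j + (S - 2 - j) = S - 2 by omega] at h2
    exact lt_asymm h1 h2

/-- If marked windows start at distance `S - 2` or `S - 1`, then `x (S - 1)` separates the
values of the two windows. -/
lemma IsMarked.lt_of_shift (h : IsMarked S x) (hS : 5 ≤ S) {j : ℕ} (hj : S - 2 ≤ j)
    (hjS : j ≤ S - 1) (h' : IsMarked S fun i => x (j + i)) {i : ℕ} (hi : i < S - 2) :
    x (S + i) < x i := by
  refine lt_trans ?_ (h.last_lt' hS (by omega))
  rcases hj.eq_or_lt with rfl | hj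
  · have h2 := h'.lt_one hS (i := i + 2) (by omega) (by omega)
    rwa [show S - 2 + (i + 2) = S + i by omega, show S - 2 + 1 = S - 1 by omega] at h2
  · obtain rfl : j = S - 1 := by omega
    have h2 := h'.lt_zero hS (i := i + 1) (by omega) (by omega)
    rwa [show S - 1 + (i + 1) = S + i by omega, show S - 1 + 0 = S - 1 by omega] at h2

end Marked

lemma isMarked_congr {α β : Type*} [LT α] [LT β] {S : ℕ} (hS : 5 ≤ S) {x : ℕ → α} {y : ℕ → β}
    (h : ∀ i j, i < S → j < S → (x i < x j ↔ y i < y j)) : IsMarked S x ↔ IsMarked S y := by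
  constructor <;> intro hx
  · exact ⟨(h _ _ (by omega) (by omega)).1 hx.1, (h _ _ (by omega) (by omega)).1 hx.2,
      fun i h1 h2 => (h _ _ (by omega) (by omega)).1 (hx.3 i h1 h2),
      fun i h1 h2 => (h _ _ (by omega) (by omega)).1 (hx.4 i h1 h2)⟩
  · exact ⟨(h _ _ (by omega) (by omega)).2 hx.1, (h _ _ (by omega) (by omega)).2 hx.2,
      fun i h1 h2 => (h _ _ (by omega) (by omega)).2 (hx.3 i h1 h2),
      fun i h1 h2 => (h _ _ (by omega) (by omega)).2 (hx.4 i h1 h2)⟩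

lemma letter_congr {α β : Type*} [LT α] [LT β] {m : ℕ} (hm : 3 ≤ m) {x : ℕ → α} {y : ℕ → β}
    (h : ∀ i j, i < 2 * m → j < 2 * m → (x i < x j ↔ y i < y j)) : letter m x = letter m y := by
  classical
  have hf : ((Finset.range m).filter fun i => x (2 * i) < x (2 * i + 1))
      = (Finset.range m).filter fun i => y (2 * i) < y (2 * i + 1) := by
    refine Finset.filter_congr fun i hi => ?_
    have := Finset.mem_range.1 hi
    exact h _ _ (by omega) (by omega)
  simp only [letter, isMarked_congr (show 5 ≤ 2 * m by omega) h]
  congr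

lemma letter_eq_iff_of_isMarked {α : Type*} [LT α] {m : ℕ} {x y : ℕ → α}
    (hx : IsMarked (2 * m) x) (hy : IsMarked (2 * m) y) (h : letter m x = letter m y) {i : ℕ}
    (hi : i < m) : x (2 * i) < x (2 * i + 1) ↔ y (2 * i) < y (2 * i + 1) := by
  simp only [letter, hx, hy, if_true, Nat.add_right_cancel_iff] at h
  have h1 := Finset.ext_iff.1 (Encodable.encode_injective h) i
  simpa [hi] using h1

/-! ### A small set of patterns meeting every cycle -/

/-- The sequence of values of `a`, starting at position `t` and continued cyclically. -/
def valuesFrom {n : ℕ} (a : Equiv.Perm (Fin (n + 1))) (t i : ℕ) : Fin (n + 1) :=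
  a ((t + i : ℕ) : Fin (n + 1))

lemma natCast_eq_mk {n k : ℕ} (h : k < n + 1) : ((k : ℕ) : Fin (n + 1)) = ⟨k, h⟩ :=
  Fin.ext (by rw [Fin.val_natCast, Nat.mod_eq_of_lt h])

lemma natCast_injOn {n i j : ℕ} (hi : i < n + 1) (hj : j < n + 1)
    (h : ((i : ℕ) : Fin (n + 1)) = (j : ℕ)) : i = j := by
  rw [natCast_eq_mk hi, natCast_eq_mk hj] at h
  simpa using h

lemma valuesFrom_mul_addRight {n : ℕ} (a : Equiv.Perm (Fin (n + 1))) (c : Fin (n + 1)) (t : ℕ) :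
    valuesFrom (a * Equiv.addRight c) t = valuesFrom a (c.1 + t) := by
  funext i
  simp only [valuesFrom, Equiv.Perm.mul_apply, Equiv.coe_addRight]
  congr 1
  push_cast
  ring

open scoped Classical in
/-- The patterns whose first letter is at least as large as all letters within the pattern. -/
noncomputable def leadingMax (n m : ℕ) : Finset (Equiv.Perm (Fin (n + 1))) :=
  Finset.univ.filter fun a => ∀ t, t + 2 * m ≤ n + 1 →
    letter m (valuesFrom a t) ≤ letter m (valuesFrom a 0)

lemma mem_leadingMax {n m : ℕ} {a : Equiv.Perm (Fin (n + 1))} :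
    a ∈ leadingMax n m ↔ ∀ t, t + 2 * m ≤ n + 1 →
      letter m (valuesFrom a t) ≤ letter m (valuesFrom a 0) := by
  simp [leadingMax]

/-- Along a directed cycle the letters within one pattern are the first letters of the following
patterns, so a pattern of the cycle with the largest first letter is in `leadingMax`. -/
theorem inducesAcyclic_compl_leadingMax {n m : ℕ} (hm : 3 ≤ m) :
    InducesAcyclic (PSG (n + 1)) (leadingMax n m)ᶜ := by
  intro M v hv hmem
  have hshift : ∀ t, t + 2 * m ≤ n + 1 → ∀ i : Fin (M + 1),
      letter m (valuesFrom (v i) t) = letter m (valuesFrom (v (i + (t : ℕ))) 0) := by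
    intro t
    induction t with
    | zero => intro _ i; simp
    | succ t ih =>
      intro ht i
      have h1 : letter m (valuesFrom (v i) (t + 1)) = letter m (valuesFrom (v (i + 1)) t) := by
        refine letter_congr hm fun p q hp hq => ?_
        have := lt_iff_lt_of_adj (hv.2 i) (i := t + p) (j := t + q) (by omega) (by omega)
        simp only [valuesFrom]
        rw [natCast_eq_mk (show t + 1 + p < n + 1 by omega),
          natCast_eq_mk (show t + 1 + q < n + 1 by omega),
          natCast_eq_mk (show t + p < n + 1 by omega),
          natCast_eq_mk (show t + q < n + 1 by omega), ← this]
        simp only [add_right_comm]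
      rw [h1, ih (by omega)]
      push_cast
      rw [add_right_comm, add_assoc]
  obtain ⟨i, hi⟩ := Finite.exists_max fun i => letter m (valuesFrom (v i) 0)
  refine Finset.mem_compl.1 (hmem i) (mem_leadingMax.2 fun t ht => ?_)
  rw [hshift t ht]
  exact hi _

/-! ### Counting permutations by rearranging blocks -/

/-- Averaging over right translates by a finite family of permutations. -/
lemma card_filter_mul_card_le {α K : Type*} [Fintype α] [DecidableEq α] [Fintype K]
    (g : K → Equiv.Perm α) (P : Equiv.Perm α → Prop) [DecidablePred P] (M : ℕ)
    (h : ∀ a, (Finset.univ.filter fun k => P (a * g k)).card ≤ M) :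
    (Finset.univ.filter P).card * Fintype.card K ≤ (Fintype.card α)! * M := by
  have h1 : ∀ k : K, (Finset.univ.filter fun a => P (a * g k)).card
      = (Finset.univ.filter P).card := fun k =>
    Finset.card_equiv (Equiv.mulRight (g k)) (by simp)
  calc (Finset.univ.filter P).card * Fintype.card K
      = ∑ k : K, (Finset.univ.filter fun a => P (a * g k)).card := by
        simp [h1, mul_comm]
    _ = ∑ a : Equiv.Perm α, (Finset.univ.filter fun k => P (a * g k)).card := by
        simp only [Finset.card_filter]
        exact Finset.sum_comm
    _ ≤ ∑ _a : Equiv.Perm α, M := Finset.sum_le_sum fun a _ => h a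
    _ = _ := by simp [Fintype.card_perm]

/-- The permutation that rearranges each of the disjoint blocks `e (b, ·)` by `k b`. -/
noncomputable def blockPerm {α : Type*} {B s : ℕ} (e : Fin B × Fin s ↪ α)
    (k : Fin B → Equiv.Perm (Fin s)) : Equiv.Perm α :=
  Equiv.Perm.viaEmbedding (Equiv.prodShear (Equiv.refl (Fin B)) k) e

lemma blockPerm_apply {α : Type*} {B s : ℕ} (e : Fin B × Fin s ↪ α)
    (k : Fin B → Equiv.Perm (Fin s)) (b : Fin B) (i : Fin s) :
    blockPerm e k (e (b, i)) = e (b, k b i) := by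
  rw [blockPerm, Equiv.Perm.viaEmbedding_apply]
  rfl

lemma blockPerm_apply_of_ne {α : Type*} {B s : ℕ} (e : Fin B × Fin s ↪ α)
    (k : Fin B → Equiv.Perm (Fin s)) {x : α} (hx : ∀ p, e p ≠ x) : blockPerm e k x = x := by
  rw [blockPerm, Equiv.Perm.viaEmbedding_apply_of_notMem]
  rintro ⟨p, hp⟩
  exact hx p hp

/-- If `P` forces a condition on the arrangement of each of `B` disjoint blocks of size `s`, and
at most `c` of the `s!` arrangements of a block satisfy it, then the proportion of the
permutations with `P` is at most `(c / s!) ^ B`. -/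
lemma card_filter_mul_pow_le {α : Type*} [Fintype α] [DecidableEq α] {B s : ℕ}
    (e : Fin B × Fin s ↪ α) (P : Equiv.Perm α → Prop) [DecidablePred P] (c : ℕ)
    (Q : Equiv.Perm α → Fin B → Equiv.Perm (Fin s) → Prop) [∀ a b, DecidablePred (Q a b)]
    (hPQ : ∀ a k, P (a * blockPerm e k) → ∀ b, Q a b (k b))
    (hQ : ∀ a b, (Finset.univ.filter (Q a b)).card ≤ c) :
    (Finset.univ.filter P).card * (s !) ^ B ≤ (Fintype.card α)! * c ^ B := by
  have := card_filter_mul_card_le (blockPerm e) P (c ^ B) fun a => ?_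
  · simpa [Fintype.card_perm] using this
  · calc (Finset.univ.filter fun k => P (a * blockPerm e k)).card
        ≤ (Fintype.piFinset fun b => Finset.univ.filter (Q a b)).card := by
          refine Finset.card_le_card fun k hk => ?_
          rw [Fintype.mem_piFinset]
          intro b
          simpa using hPQ a k (by simpa using hk) b
      _ = ∏ b, (Finset.univ.filter (Q a b)).card := Fintype.card_piFinset _
      _ ≤ ∏ _b : Fin B, c := Finset.prod_le_prod' fun b _ => hQ a b
      _ = c ^ B := by simp

/-- If `P` prescribes the order within each of `m` disjoint pairs, in terms of data that are not
changed by swapping these pairs, then the proportion of the permutations with `P` is at most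
`1 / 2 ^ m`. -/
lemma card_filter_mul_two_pow_le {α : Type*} [Fintype α] [LinearOrder α] {m : ℕ}
    (e : Fin m × Fin 2 ↪ α) (P : Equiv.Perm α → Prop) [DecidablePred P]
    (β : Equiv.Perm α → Fin m → Prop)
    (hP : ∀ a k, P (a * blockPerm e k) → ∀ i, (a (e (i, k i 0)) < a (e (i, k i 1)) ↔ β a i)) :
    (Finset.univ.filter P).card * 2 ^ m ≤ (Fintype.card α)! := by
  classical
  have := card_filter_mul_pow_le e P 1
    (fun a i σ => (a (e (i, σ 0)) < a (e (i, σ 1)) ↔ β a i)) hP fun a i => ?_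
  · simpa using this
  · refine Finset.card_le_one.2 fun σ hσ τ hτ => ?_
    simp only [Finset.mem_filter, Finset.mem_univ, true_and] at hσ hτ
    have h1 := hσ.trans hτ.symm
    have hne : a (e (i, 0)) ≠ a (e (i, 1)) := fun h => by simpa using e.injective (a.injective h)
    have hc : ∀ ρ : Equiv.Perm (Fin 2), (ρ = 1) ∨ ρ = Equiv.swap 0 1 := by decide
    rcases hc σ with rfl | rfl <;> rcases hc τ with rfl | rfl <;>
      first
      | rfl
      | (exfalso
         simp only [Equiv.Perm.coe_one, id_eq, Equiv.swap_apply_left,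
           Equiv.swap_apply_right] at h1
         rcases lt_or_gt_of_ne hne with h | h
         · have := h1; have := lt_asymm h; tauto
         · have := h1; have := lt_asymm h; tauto)

/-! ### Two positions with leading letters -/

/-- The embedding into `Fin (n + 1)` given by an injective function to `[0, n]`. -/
def embOfNat {β : Type*} {n : ℕ} (f : β → ℕ) (hf : Function.Injective f)
    (hlt : ∀ p, f p < n + 1) : β ↪ Fin (n + 1) :=
  ⟨fun p => (f p : ℕ), fun p q h => hf (natCast_injOn (hlt p) (hlt q) h)⟩

lemma embOfNat_apply {β : Type*} {n : ℕ} (f : β → ℕ) (hf : Function.Injective f)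
    (hlt : ∀ p, f p < n + 1) (p : β) :
    embOfNat f hf hlt p = ((f p : ℕ) : Fin (n + 1)) := rfl

section Pairs

variable {n m : ℕ}

open scoped Classical in
/-- The patterns in `leadingMax` that start with a marked window. -/
noncomputable def markedLeadingMax (n m : ℕ) : Finset (Equiv.Perm (Fin (n + 1))) :=
  (leadingMax n m).filter fun a => IsMarked (2 * m) (valuesFrom a 0)

lemma mem_markedLeadingMax {a : Equiv.Perm (Fin (n + 1))} :
    a ∈ markedLeadingMax n m ↔ (∀ t, t + 2 * m ≤ n + 1 →
      letter m (valuesFrom a t) ≤ letter m (valuesFrom a 0)) ∧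
      IsMarked (2 * m) (valuesFrom a 0) := by
  simp [markedLeadingMax, mem_leadingMax]

lemma valuesFrom_zero_apply (a : Equiv.Perm (Fin (n + 1))) (i : ℕ) :
    valuesFrom a 0 i = a ((i : ℕ) : Fin (n + 1)) := by
  simp [valuesFrom]

/-- The proportion of permutations whose first window dominates the second one entrywise (in
the first `m` places) is at most `1 / 2 ^ m`. -/
lemma card_dominating_mul_le (h4 : 4 * m ≤ n + 1)
    (P : Equiv.Perm (Fin (n + 1)) → Prop) [DecidablePred P]
    (hP : ∀ a, P a → ∀ i < m, valuesFrom a 0 (2 * m + i) < valuesFrom a 0 i) :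
    (Finset.univ.filter P).card * 2 ^ m ≤ (n + 1)! := by
  let f : Fin m × Fin 2 → ℕ := fun p => 2 * m * p.2.1 + p.1.1
  have hf : Function.Injective f := by
    rintro ⟨i, b⟩ ⟨j, c⟩ h
    have hi := i.2
    have hj := j.2
    simp only [f] at h
    fin_cases b <;> fin_cases c <;> simp at h <;> simp [Fin.ext_iff] <;> omega
  have hlt : ∀ p, f p < n + 1 := by
    rintro ⟨i, b⟩
    have hi := i.2
    simp only [f]
    fin_cases b <;> simp <;> omega
  have := card_filter_mul_two_pow_le (embOfNat f hf hlt) P (fun _ _ => False) ?_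
  · simpa using this
  · intro a k h i
    have h1 := hP _ h i.1 i.2
    rw [valuesFrom_zero_apply, valuesFrom_zero_apply] at h1
    have e0 : ((i.1 : ℕ) : Fin (n + 1)) = embOfNat f hf hlt (i, 0) := by
      simp [embOfNat_apply, f]
    have e1 : ((2 * m + i.1 : ℕ) : Fin (n + 1)) = embOfNat f hf hlt (i, 1) := by
      simp [embOfNat_apply, f]
    rw [e0, e1, Equiv.Perm.mul_apply, Equiv.Perm.mul_apply, blockPerm_apply,
      blockPerm_apply] at h1
    simpa using h1.le

/-- The proportion of permutations with the same comparisons within the pairs of two disjoint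
windows is at most `1 / 2 ^ m`. -/
lemma card_tie_mul_le {j : ℕ} (hj : 2 * m ≤ j) (hjn : j + 2 * m ≤ n + 1)
    (P : Equiv.Perm (Fin (n + 1)) → Prop) [DecidablePred P]
    (hP : ∀ a, P a → ∀ i < m, (valuesFrom a j (2 * i) < valuesFrom a j (2 * i + 1) ↔
      valuesFrom a 0 (2 * i) < valuesFrom a 0 (2 * i + 1))) :
    (Finset.univ.filter P).card * 2 ^ m ≤ (n + 1)! := by
  let f : Fin m × Fin 2 → ℕ := fun p => j + (2 * p.1.1 + p.2.1)
  have hf : Function.Injective f := by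
    rintro ⟨i, b⟩ ⟨i', c⟩ h
    have hb := b.2
    have hc := c.2
    simp only [f] at h
    simp only [Prod.mk.injEq, Fin.ext_iff]
    omega
  have hlt : ∀ p, f p < n + 1 := by
    rintro ⟨i, b⟩
    have hi := i.2
    have hb := b.2
    simp only [f]
    omega
  have := card_filter_mul_two_pow_le (embOfNat f hf hlt) P
    (fun a i => valuesFrom a 0 (2 * i.1) < valuesFrom a 0 (2 * i.1 + 1)) ?_
  · simpa using this
  · intro a k h i
    have h1 := hP _ h i.1 i.2
    have e0 : ((j + 2 * i.1 : ℕ) : Fin (n + 1)) = embOfNat f hf hlt (i, 0) := by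
      simp [embOfNat_apply, f]
    have e1 : ((j + (2 * i.1 + 1) : ℕ) : Fin (n + 1)) = embOfNat f hf hlt (i, 1) := by
      simp [embOfNat_apply, f]
    -- The first window is not moved by the block permutation.
    have hfix : ∀ q, q < 2 * m → blockPerm (embOfNat f hf hlt) k ((q : ℕ) : Fin (n + 1))
        = (q : ℕ) := by
      intro q hq
      refine blockPerm_apply_of_ne _ _ fun p hp => ?_
      rw [embOfNat_apply] at hp
      have := natCast_injOn (hlt p) (by omega) hp
      simp only [f] at this
      omega
    have hi := i.2
    rw [valuesFrom_zero_apply, valuesFrom_zero_apply, Equiv.Perm.mul_apply,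
      Equiv.Perm.mul_apply, hfix _ (by omega), hfix _ (by omega)] at h1
    rw [valuesFrom_zero_apply, valuesFrom_zero_apply, ← h1, valuesFrom, valuesFrom, e0, e1,
      Equiv.Perm.mul_apply, Equiv.Perm.mul_apply, blockPerm_apply, blockPerm_apply]

lemma card_pair_mul_le_of_le (hm : 3 ≤ m) (h4 : 4 * m ≤ n + 1) {j : Fin (n + 1)} (hj : j ≠ 0)
    (hjn : j.1 + 2 * m ≤ n + 1) :
    (Finset.univ.filter fun a => a ∈ markedLeadingMax n m ∧
      a * Equiv.addRight j ∈ markedLeadingMax n m).card * 2 ^ m ≤ (n + 1)! := by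
  have hj0 : 0 < j.1 := Fin.pos_iff_ne_zero.2 hj
  have hshift : ∀ a : Equiv.Perm (Fin (n + 1)),
      valuesFrom a j.1 = fun i => valuesFrom a 0 (j.1 + i) := by
    intro a
    funext i
    simp [valuesFrom]
  rcases Nat.lt_or_ge j.1 (2 * m) with hlt | hge
  · refine card_dominating_mul_le h4 _ fun a ha i hi => ?_
    obtain ⟨h1, h2⟩ := ha
    have h1 := (mem_markedLeadingMax.1 h1).2
    have h2 := (mem_markedLeadingMax.1 h2).2
    rw [valuesFrom_mul_addRight, add_zero, hshift] at h2
    have h3 : ¬ j.1 ≤ 2 * m - 3 := fun h => h1.not_isMarked_shift (by omega) hj0 h h2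
    exact h1.lt_of_shift (by omega) (j := j.1) (by omega) (by omega) h2 (by omega)
  -- The two windows are disjoint and each is within the pattern starting at the other one, so
  -- their letters are equal.
  · refine card_tie_mul_le hge hjn _ fun a ha i hi => ?_
    obtain ⟨h1, h2⟩ := ha
    rw [mem_markedLeadingMax] at h1 h2
    rw [valuesFrom_mul_addRight, add_zero] at h2
    have h3 := h1.1 j.1 hjn
    have h4 := h2.1 (n + 1 - j.1) (by omega)
    rw [valuesFrom_mul_addRight, show j.1 + (n + 1 - j.1) = n + 1 by omega] at h4
    have h5 : valuesFrom a (n + 1) = valuesFrom a 0 := by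
      funext i
      simp [valuesFrom]
    rw [h5] at h4
    exact letter_eq_iff_of_isMarked h2.2 h1.2 (le_antisymm h3 h4) hi

lemma card_pair_mul_le (hm : 3 ≤ m) (h4 : 4 * m ≤ n + 1) {j : Fin (n + 1)} (hj : j ≠ 0) :
    (Finset.univ.filter fun a => a ∈ markedLeadingMax n m ∧
      a * Equiv.addRight j ∈ markedLeadingMax n m).card * 2 ^ m ≤ (n + 1)! := by
  rcases Nat.lt_or_ge (n + 1) (j.1 + 2 * m) with h | h
  -- Seen from the second window, the first one is at cyclic distance `-j`, which is small.
  · have hneg : (-j).1 = n + 1 - j.1 := by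
      have := j.2
      rw [Fin.val_neg, if_neg hj]
    have := card_pair_mul_le_of_le hm h4 (neg_ne_zero.2 hj) (by rw [hneg]; omega)
    convert this using 2
    refine Finset.card_equiv (Equiv.mulRight (Equiv.addRight j)) fun a => ?_
    have h1 : a * Equiv.addRight j * Equiv.addRight (-j) = a := by
      ext i
      simp
    simp only [Finset.mem_filter, Finset.mem_univ, true_and, Equiv.coe_mulRight, h1]
    exact and_comm
  · exact card_pair_mul_le_of_le hm h4 hj h

/-- Among the rotations of a permutation typically at most one is in `markedLeadingMax`, so the
proportion of this set is at most `1 / r` up to a small error. -/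
theorem card_markedLeadingMax_le (hm : 3 ≤ m) (h4 : 4 * m ≤ n + 1) :
    (n + 1) * (markedLeadingMax n m).card * 2 ^ m ≤ (n + 1)! * (2 ^ m + (n + 1) ^ 2) := by
  classical
  set F := markedLeadingMax n m with hF
  -- The number of rotations in `F` is at most one plus the number of ordered pairs of them.
  have hN : ∀ a : Equiv.Perm (Fin (n + 1)),
      (Finset.univ.filter fun t => a * Equiv.addRight t ∈ F).card ≤
        1 + ∑ t : Fin (n + 1), ∑ j ∈ Finset.univ.erase (0 : Fin (n + 1)),
          (if a * Equiv.addRight t ∈ F ∧ a * Equiv.addRight t * Equiv.addRight j ∈ F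
            then 1 else 0) := by
    intro a
    set N := Finset.univ.filter fun t => a * Equiv.addRight t ∈ F with hNdef
    rcases N.eq_empty_or_nonempty with h | ⟨t, ht⟩
    · simp [h]
    · have h1 : N.card ≤ 1 + ∑ j ∈ Finset.univ.erase (0 : Fin (n + 1)),
          (if a * Equiv.addRight t ∈ F ∧ a * Equiv.addRight t * Equiv.addRight j ∈ F
            then 1 else 0) := by
        have ht' : a * Equiv.addRight t ∈ F := by simpa [hNdef] using ht
        rw [← Finset.card_erase_add_one ht, add_comm, ← Finset.card_filter]
        refine Nat.add_le_add_left ?_ _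
        refine Finset.card_le_card_of_injOn (fun s => s - t) ?_ (fun s _ s' _ h => by simpa using h)
        intro s hs
        obtain ⟨hst, hs⟩ := Finset.mem_erase.1 hs
        have hs : a * Equiv.addRight s ∈ F := by simpa [hNdef] using hs
        have h2 : a * Equiv.addRight t * Equiv.addRight (s - t) = a * Equiv.addRight s := by
          ext i
          simp [add_assoc]
        simp [ht', h2, hs, sub_eq_zero, hst]
      refine h1.trans (Nat.add_le_add_left ?_ _)
      exact Finset.single_le_sum (f := fun t => ∑ j ∈ Finset.univ.erase (0 : Fin (n + 1)),
          (if a * Equiv.addRight t ∈ F ∧ a * Equiv.addRight t * Equiv.addRight j ∈ F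
            then 1 else 0)) (fun _ _ => Nat.zero_le _) (Finset.mem_univ t)
  have hrot : ∀ (t : Fin (n + 1)) (P : Equiv.Perm (Fin (n + 1)) → Prop) [DecidablePred P],
      ∑ a, (if P (a * Equiv.addRight t) then 1 else 0) = (Finset.univ.filter P).card := by
    intro t P _
    rw [Finset.card_filter]
    exact Equiv.sum_comp (Equiv.mulRight (Equiv.addRight t)) fun a => if P a then 1 else 0
  have hsum : (n + 1) * F.card ≤ (n + 1)! + (n + 1) * ∑ j ∈ Finset.univ.erase (0 : Fin (n + 1)),
      (Finset.univ.filter fun a => a ∈ F ∧ a * Equiv.addRight j ∈ F).card := by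
    calc (n + 1) * F.card
        = ∑ t : Fin (n + 1), ∑ a, (if a * Equiv.addRight t ∈ F then 1 else 0) := by
          simp [hrot _ fun a => a ∈ F]
      _ = ∑ a, (Finset.univ.filter fun t => a * Equiv.addRight t ∈ F).card := by
          rw [Finset.sum_comm]
          simp only [Finset.card_filter]
      _ ≤ _ := Finset.sum_le_sum fun a _ => hN a
      _ = _ := by
          rw [Finset.sum_add_distrib, Finset.sum_comm]
          congr 1
          · simp [Fintype.card_perm]
          · refine (Finset.sum_congr rfl fun t _ => ?_).trans (Fin.sum_const (n + 1) _)
            rw [Finset.sum_comm]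
            refine Finset.sum_congr rfl fun j _ => ?_
            exact hrot t fun a => a ∈ F ∧ a * Equiv.addRight j ∈ F
  have hpairs : (∑ j ∈ Finset.univ.erase (0 : Fin (n + 1)),
      (Finset.univ.filter fun a => a ∈ F ∧ a * Equiv.addRight j ∈ F).card) * 2 ^ m
      ≤ (n + 1) * (n + 1)! := by
    rw [Finset.sum_mul]
    calc _ ≤ ∑ _j ∈ Finset.univ.erase (0 : Fin (n + 1)), (n + 1)! := by
          refine Finset.sum_le_sum fun j hj => ?_
          convert card_pair_mul_le hm h4 (Finset.ne_of_mem_erase hj)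
      _ ≤ _ := by
          rw [Finset.sum_const, smul_eq_mul]
          refine Nat.mul_le_mul_right _ ?_
          exact (Finset.card_le_univ _).trans (by simp)
  calc (n + 1) * F.card * 2 ^ m ≤ _ := Nat.mul_le_mul_right _ hsum
    _ = (n + 1)! * 2 ^ m + (n + 1) * ((∑ j ∈ Finset.univ.erase (0 : Fin (n + 1)),
      (Finset.univ.filter fun a => a ∈ F ∧ a * Equiv.addRight j ∈ F).card) * 2 ^ m) := by ring
    _ ≤ (n + 1)! * 2 ^ m + (n + 1) * ((n + 1) * (n + 1)!) := by gcongr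
    _ = _ := by ring

end Pairs

/-! ### Patterns without marked windows -/

/-- The rearrangement turning a decreasing sequence of length `S` into one with a marked window:
the third largest term is moved to the last place but one. -/
def markingPerm (S : ℕ) (hS : 5 ≤ S) : Equiv.Perm (Fin S) where
  toFun i := ⟨if i.1 < 2 then i.1 else if i.1 = S - 2 then 2 else
    if i.1 < S - 2 then i.1 + 1 else i.1, by have := i.2; split_ifs <;> omega⟩
  invFun j := ⟨if j.1 < 2 then j.1 else if j.1 = 2 then S - 2 else
    if j.1 ≤ S - 2 then j.1 - 1 else j.1, by have := j.2; split_ifs <;> omega⟩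
  left_inv i := by
    have := i.2
    apply Fin.ext
    dsimp only
    split_ifs <;> omega
  right_inv i := by
    have := i.2
    apply Fin.ext
    dsimp only
    split_ifs <;> omega

/-- The inclusion of the positions other than the first two and the last two. -/
def innerEmb (S : ℕ) (hS : 5 ≤ S) : Fin (S - 4) ↪ Fin S :=
  ⟨fun i => ⟨i.1 + 2, by have := i.2; omega⟩, fun i j h => by simpa [Fin.ext_iff] using h⟩

lemma val_innerEmb {S : ℕ} (hS : 5 ≤ S) (i : Fin (S - 4)) : (innerEmb S hS i).1 = i.1 + 2 := rfl

open scoped Classical in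
/-- At least `(S - 4)!` rearrangements of a sequence of `S` distinct terms make it marked. -/
lemma factorial_le_card_isMarked {α : Type*} [LinearOrder α] {S : ℕ} (hS : 5 ≤ S)
    (w : Fin S → α) (hw : Function.Injective w) :
    (S - 4)! ≤ (Finset.univ.filter fun σ : Equiv.Perm (Fin S) =>
      ∀ y : ℕ → α, (∀ i (hi : i < S), y i = w (σ ⟨i, hi⟩)) → IsMarked S y).card := by
  obtain ⟨τ, hτ⟩ : ∃ τ : Equiv.Perm (Fin S), StrictAnti (w ∘ τ) := by
    refine ⟨Tuple.sort (OrderDual.toDual ∘ w), ?_⟩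
    have h1 := Tuple.monotone_sort (OrderDual.toDual ∘ w)
    refine Antitone.strictAnti_of_injective (fun i j hij => h1 hij)
      (hw.comp (Equiv.injective _))
  have key : ∀ i j : Fin S, i < j → w (τ j) < w (τ i) := fun i j h => hτ h
  have hcard : (S - 4)! = (Finset.univ.image fun ρ : Equiv.Perm (Fin (S - 4)) =>
      τ * markingPerm S hS * Equiv.Perm.viaEmbeddingHom (innerEmb S hS) ρ).card := by
    rw [Finset.card_image_of_injective _ fun ρ ρ' h =>
      Equiv.Perm.viaEmbeddingHom_injective _ (mul_left_cancel h)]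
    simp [Fintype.card_perm]
  rw [hcard]
  refine Finset.card_le_card fun σ hσ => ?_
  obtain ⟨ρ, -, rfl⟩ := Finset.mem_image.1 hσ
  simp only [Finset.mem_filter, Finset.mem_univ, true_and]
  intro y hy
  set v := Equiv.Perm.viaEmbeddingHom (innerEmb S hS) ρ with hv
  have hout : ∀ i (hi : i < S), i < 2 ∨ S - 2 ≤ i → v ⟨i, hi⟩ = ⟨i, hi⟩ := by
    intro i hi h
    rw [hv, Equiv.Perm.viaEmbeddingHom_apply, Equiv.Perm.viaEmbedding_apply_of_notMem]
    rintro ⟨p, hp⟩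
    have := p.2
    have h1 := congrArg Fin.val hp
    rw [val_innerEmb] at h1
    dsimp only at h1
    omega
  have hin : ∀ i (hi : i < S), 2 ≤ i → i < S - 2 → 2 ≤ (v ⟨i, hi⟩).1 ∧ (v ⟨i, hi⟩).1 < S - 2 := by
    intro i hi h2 h3
    have h4 : (⟨i, hi⟩ : Fin S) = innerEmb S hS ⟨i - 2, by omega⟩ := by
      apply Fin.ext
      rw [val_innerEmb]
      dsimp only
      omega
    rw [h4, hv, Equiv.Perm.viaEmbeddingHom_apply, Equiv.Perm.viaEmbedding_apply]
    have := (ρ ⟨i - 2, by omega⟩).2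
    rw [val_innerEmb]
    omega
  have hval : ∀ i (hi : i < S), y i = w (τ (markingPerm S hS (v ⟨i, hi⟩))) := hy
  refine ⟨?_, ?_, fun i h2 h3 => ?_, fun i h2 h3 => ?_⟩
  · rw [hval 1 (by omega), hval 0 (by omega), hout _ _ (by omega), hout _ _ (by omega)]
    apply key
    simp [markingPerm, Fin.lt_def]
  · rw [hval (S - 2) (by omega), hval 1 (by omega), hout _ _ (by omega), hout _ _ (by omega)]
    apply key
    simp only [markingPerm, Fin.lt_def, Equiv.coe_fn_mk]
    split_ifs <;> omega
  · rw [hval (S - 2) (by omega), hval i (by omega), hout (S - 2) _ (by omega)]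
    have := hin i (by omega) h2 h3
    apply key
    simp only [markingPerm, Fin.lt_def, Equiv.coe_fn_mk]
    split_ifs <;> omega
  · rw [hval (S - 1) (by omega), hval i (by omega), hout (S - 1) _ (by omega)]
    have := hin i (by omega) h2 h3
    apply key
    simp only [markingPerm, Fin.lt_def, Equiv.coe_fn_mk]
    split_ifs <;> omega

open scoped Classical in
/-- The patterns in which no window is marked. -/
noncomputable def unmarked (n S : ℕ) : Finset (Equiv.Perm (Fin (n + 1))) :=
  Finset.univ.filter fun a => ∀ t, t + S ≤ n + 1 → ¬ IsMarked S (valuesFrom a t)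

theorem card_unmarked_le {n S B : ℕ} (hS : 5 ≤ S) (hB : S * B ≤ n + 1) :
    (unmarked n S).card * (S)! ^ B ≤ (n + 1)! * ((S)! - (S - 4)!) ^ B := by
  classical
  let f : Fin B × Fin S → ℕ := fun p => S * p.1.1 + p.2.1
  have hf : Function.Injective f := by
    rintro ⟨b, i⟩ ⟨b', i'⟩ h
    have hi := i.2
    have hi' := i'.2
    simp only [f] at h
    have h1 := congrArg (· / S) h
    have h2 := congrArg (· % S) h
    simp only [Nat.mul_add_div (show S > 0 by omega), Nat.div_eq_of_lt hi,
      Nat.div_eq_of_lt hi', add_zero, Nat.mul_add_mod, Nat.mod_eq_of_lt hi,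
      Nat.mod_eq_of_lt hi'] at h1 h2
    simp [Prod.ext_iff, Fin.ext_iff, h1, h2]
  have hblock : ∀ b : Fin B, S * b.1 + S ≤ n + 1 := by
    intro b
    calc S * b.1 + S = S * (b.1 + 1) := by ring
      _ ≤ S * B := Nat.mul_le_mul_left _ b.2
      _ ≤ n + 1 := hB
  have hlt : ∀ p, f p < n + 1 := by
    rintro ⟨b, i⟩
    have hi := i.2
    have := hblock b
    simp only [f]
    omega
  have := card_filter_mul_pow_le (embOfNat f hf hlt)
    (fun a => ∀ t, t + S ≤ n + 1 → ¬ IsMarked S (valuesFrom a t)) ((S)! - (S - 4)!)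
    (fun a b σ => ¬ ∀ y : ℕ → Fin (n + 1),
      (∀ i (hi : i < S), y i = a (embOfNat f hf hlt (b, σ ⟨i, hi⟩))) → IsMarked S y) ?_ ?_
  · simpa [unmarked] using this
  · intro a k h b hall
    refine h (S * b.1) (hblock b) (hall _ fun i hi => ?_)
    rw [← blockPerm_apply, embOfNat_apply]
    rfl
  · intro a b
    have h1 := factorial_le_card_isMarked hS (fun i => a (embOfNat f hf hlt (b, i)))
      fun i j h => by simpa using (embOfNat f hf hlt).injective (a.injective h)
    have h2 := Finset.card_filter_add_card_filter_not (s := Finset.univ)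
      fun σ : Equiv.Perm (Fin S) => ∀ y : ℕ → Fin (n + 1),
      (∀ i (hi : i < S), y i = a (embOfNat f hf hlt (b, σ ⟨i, hi⟩))) → IsMarked S y
    rw [Finset.card_univ, Fintype.card_perm, Fintype.card_fin] at h2
    omega

lemma leadingMax_subset {n m : ℕ} :
    leadingMax n m ⊆ markedLeadingMax n m ∪ unmarked n (2 * m) := by
  intro a ha
  rw [Finset.mem_union]
  by_cases h : IsMarked (2 * m) (valuesFrom a 0)
  · exact Or.inl (mem_markedLeadingMax.2 ⟨mem_leadingMax.1 ha, h⟩)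
  · refine Or.inr ?_
    simp only [unmarked, Finset.mem_filter, Finset.mem_univ, true_and]
    intro t ht h'
    have := mem_leadingMax.1 ha t ht
    simp [letter, h, h'] at this

end Rotations

/-! ### The lower bound on the acyclic number -/

lemma card_markedLeadingMax_div_le {n m : ℕ} (hm : 3 ≤ m) (h4 : 4 * m ≤ n + 1)
    (h2 : (n + 1) ^ 3 ≤ 2 ^ m) :
    ((markedLeadingMax n m).card : ℝ) / ((n + 1)! : ℝ)
      ≤ 1 / ((n : ℝ) + 1) + 1 / ((n : ℝ) + 1) ^ 2 := by
  have h := card_markedLeadingMax_le hm h4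
  have h' : ((n : ℝ) + 1) * (markedLeadingMax n m).card * 2 ^ m
      ≤ ((n + 1)! : ℝ) * (2 ^ m + ((n : ℝ) + 1) ^ 2) := by exact_mod_cast h
  have h2' : ((n : ℝ) + 1) ^ 3 ≤ 2 ^ m := by exact_mod_cast h2
  have hr : (0 : ℝ) < (n : ℝ) + 1 := by positivity
  have hf : (0 : ℝ) < ((n + 1)! : ℝ) := by positivity
  have hp : (0 : ℝ) < (2 : ℝ) ^ m := by positivity
  have e1 : ((markedLeadingMax n m).card : ℝ) / ((n + 1)! : ℝ)
      ≤ (2 ^ m + ((n : ℝ) + 1) ^ 2) / (((n : ℝ) + 1) * 2 ^ m) := by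
    rw [div_le_div_iff₀ hf (by positivity)]
    linarith
  have e2 : (2 ^ m + ((n : ℝ) + 1) ^ 2) / (((n : ℝ) + 1) * 2 ^ m)
      = 1 / ((n : ℝ) + 1) + ((n : ℝ) + 1) / 2 ^ m := by
    field_simp
  have e3 : ((n : ℝ) + 1) / 2 ^ m ≤ 1 / ((n : ℝ) + 1) ^ 2 := by
    rw [div_le_div_iff₀ hp (by positivity)]
    linarith
  linarith

lemma card_unmarked_div_le {n L : ℕ} (hL : 1 ≤ L) (hr : n + 1 ≤ 2 ^ L)
    (hlarge : 2 * L * (6 * L) ^ 5 ≤ n + 1) :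
    ((unmarked n (6 * L)).card : ℝ) / ((n + 1)! : ℝ) ≤ 1 / ((n : ℝ) + 1) ^ 2 := by
  set S := 6 * L with hS
  -- This number of blocks makes `(1 - 1 / S ^ 4) ^ B` at most `exp (-2 * L) ≤ 1 / r ^ 2`.
  set B := 2 * L * S ^ 4 with hB
  have hSB : S * B ≤ n + 1 := by
    calc S * B = 2 * L * S ^ 5 := by rw [hB]; ring
      _ ≤ n + 1 := hlarge
  have h := card_unmarked_le (show 5 ≤ S by omega) hSB
  have hle : (S - 4)! ≤ (S)! := Nat.factorial_le (by omega)
  have h' : ((unmarked n S).card : ℝ) * ((S)! : ℝ) ^ B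
      ≤ ((n + 1)! : ℝ) * (((S)! : ℝ) - ((S - 4)! : ℝ)) ^ B := by
    rw [← Nat.cast_sub hle]
    exact_mod_cast h
  have hf : (0 : ℝ) < ((n + 1)! : ℝ) := by positivity
  have hg : (0 : ℝ) < ((S)! : ℝ) := by positivity
  have hSpos : (0 : ℝ) < (S : ℝ) := by
    have : 0 < S := by omega
    exact_mod_cast this
  have hfac : ((S)! : ℝ) ≤ (S : ℝ) ^ 4 * ((S - 4)! : ℝ) := by
    have h1 := Nat.factorial_mul_descFactorial (show 4 ≤ S by omega)
    have h2 := Nat.descFactorial_le_pow S 4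
    have h3 : (S)! ≤ S ^ 4 * (S - 4)! := by
      rw [← h1, mul_comm]
      exact Nat.mul_le_mul_right _ h2
    exact_mod_cast h3
  have e1 : ((unmarked n S).card : ℝ) / ((n + 1)! : ℝ)
      ≤ ((((S)! : ℝ) - ((S - 4)! : ℝ)) / ((S)! : ℝ)) ^ B := by
    rw [div_pow, div_le_div_iff₀ hf (by positivity)]
    linarith
  have e2 : (((S)! : ℝ) - ((S - 4)! : ℝ)) / ((S)! : ℝ) ≤ Real.exp (-(1 / (S : ℝ) ^ 4)) := by
    refine le_trans ?_ (Real.one_sub_le_exp_neg _)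
    rw [sub_div, div_self hg.ne']
    refine sub_le_sub_left ?_ _
    rw [div_le_div_iff₀ (by positivity) hg]
    linarith
  have e0 : 0 ≤ (((S)! : ℝ) - ((S - 4)! : ℝ)) / ((S)! : ℝ) := by
    refine div_nonneg (sub_nonneg.2 ?_) hg.le
    exact_mod_cast hle
  have e3 : Real.exp (-(1 / (S : ℝ) ^ 4)) ^ B = (Real.exp (-(L : ℝ))) ^ 2 := by
    rw [← Real.exp_nat_mul, ← Real.exp_nat_mul, hB]
    congr 1
    push_cast
    field_simp
  have e4 : Real.exp (-(L : ℝ)) ≤ 1 / ((n : ℝ) + 1) := by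
    rw [Real.exp_neg, ← one_div]
    refine one_div_le_one_div_of_le (by positivity) ?_
    calc (n : ℝ) + 1 ≤ 2 ^ L := by exact_mod_cast hr
      _ ≤ Real.exp 1 ^ L := by
        gcongr
        have := Real.add_one_le_exp 1
        linarith
      _ = Real.exp L := by rw [← Real.exp_nat_mul, mul_one]
  calc ((unmarked n S).card : ℝ) / ((n + 1)! : ℝ) ≤ _ := e1
    _ ≤ Real.exp (-(1 / (S : ℝ) ^ 4)) ^ B := pow_le_pow_left₀ e0 e2 B
    _ = _ := e3
    _ ≤ (1 / ((n : ℝ) + 1)) ^ 2 := pow_le_pow_left₀ (Real.exp_pos _).le e4 2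
    _ = _ := by rw [div_pow, one_pow]

lemma exists_forall_mul_pow_le_two_pow :
    ∃ L₀ : ℕ, ∀ L, L₀ ≤ L → 2 * (2 * L * (6 * L) ^ 5) ≤ 2 ^ L := by
  have h := tendsto_pow_const_div_const_pow_of_one_lt 6 (one_lt_two : (1 : ℝ) < 2)
  obtain ⟨L₀, hL₀⟩ := eventually_atTop.1
    (h.eventually (gt_mem_nhds (show (0 : ℝ) < 1 / 31104 by norm_num)))
  refine ⟨L₀, fun L hL => ?_⟩
  have h1 := hL₀ L hL
  rw [div_lt_div_iff₀ (by positivity) (by norm_num)] at h1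
  have h2 : L ^ 6 * 31104 < 1 * 2 ^ L := by exact_mod_cast h1
  calc 2 * (2 * L * (6 * L) ^ 5) = L ^ 6 * 31104 := by ring
    _ ≤ 2 ^ L := by omega

theorem exists_forall_le_acyclicNumber_div :
    ∃ r₀ : ℕ, ∀ r : ℕ, r₀ ≤ r →
      1 - 1 / (r : ℝ) - 2 / (r : ℝ) ^ 2 ≤ (acyclicNumber (PSG r) : ℝ) / (r ! : ℝ) := by
  classical
  obtain ⟨L₀, hL₀⟩ := exists_forall_mul_pow_le_two_pow
  refine ⟨2 ^ L₀, fun r hr => ?_⟩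
  obtain ⟨n, rfl⟩ : ∃ n, r = n + 1 :=
    ⟨r - 1, by have := Nat.one_le_two_pow (n := L₀); omega⟩
  -- The windows have length `S = 6 * L`, where `2 ^ (L - 1) ≤ r < 2 ^ L`.
  set L := Nat.log 2 (n + 1) + 1 with hL
  have hlt : n + 1 < 2 ^ L := Nat.lt_pow_succ_log_self (by norm_num) _
  have hge : 2 ^ (L - 1) ≤ n + 1 := Nat.pow_log_le_self 2 (by omega)
  have hLL : L₀ ≤ L := (Nat.pow_lt_pow_iff_right (by norm_num)).1 (hr.trans_lt hlt) |>.le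
  have hbig := hL₀ L hLL
  have h2 : 2 ^ L = 2 * 2 ^ (L - 1) := by rw [hL, Nat.add_sub_cancel, pow_succ]; ring
  have hlarge : 2 * L * (6 * L) ^ 5 ≤ n + 1 := by omega
  have h4 : 4 * (3 * L) ≤ n + 1 := by
    refine le_trans ?_ hlarge
    calc 4 * (3 * L) = 2 * (6 * L) ^ 1 := by ring
      _ ≤ 2 * (6 * L) ^ 5 := Nat.mul_le_mul_left _ (Nat.pow_le_pow_right (by omega) (by norm_num))
      _ ≤ 2 * L * (6 * L) ^ 5 := Nat.mul_le_mul_right _ (by omega)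
  have hF1 := card_markedLeadingMax_div_le (n := n) (m := 3 * L) (by omega) h4 (by
    rw [mul_comm 3 L, pow_mul]
    exact Nat.pow_le_pow_left hlt.le 3)
  have hF0 := card_unmarked_div_le (n := n) (by omega) hlt.le hlarge
  have hac := (inducesAcyclic_compl_leadingMax (n := n) (m := 3 * L)
    (by omega)).card_le_acyclicNumber
  have hcompl := Finset.card_add_card_compl (leadingMax n (3 * L))
  rw [Fintype.card_perm, Fintype.card_fin] at hcompl
  have hsub := (Finset.card_le_card (leadingMax_subset (n := n) (m := 3 * L))).trans
    (Finset.card_union_le _ _)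
  rw [show 2 * (3 * L) = 6 * L by ring] at hsub
  have hnat : (n + 1)! ≤ acyclicNumber (PSG (n + 1)) +
      ((markedLeadingMax n (3 * L)).card + (unmarked n (6 * L)).card) := by omega
  have hreal : ((n + 1)! : ℝ) ≤ acyclicNumber (PSG (n + 1)) +
      ((markedLeadingMax n (3 * L)).card + (unmarked n (6 * L)).card) := by exact_mod_cast hnat
  have hf : (0 : ℝ) < ((n + 1)! : ℝ) := by positivity
  have hdiv := div_le_div_of_nonneg_right hreal hf.le
  rw [div_self hf.ne', add_div, add_div] at hdiv
  push_cast at hdiv hF1 hF0 ⊢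
  have : (2 : ℝ) / ((n : ℝ) + 1) ^ 2 = 1 / ((n : ℝ) + 1) ^ 2 + 1 / ((n : ℝ) + 1) ^ 2 := by ring
  linarith

/-! ### Ramsey's theorem for uniform hypergraphs -/

/-- Ramsey's theorem for colourings of the `r`-subsets of a finite set of natural numbers. -/
theorem exists_monochromatic_finset {κ : Type*} [Finite κ] (r N : ℕ) :
    ∃ n : ℕ, ∀ (c : Finset ℕ → κ) (X : Finset ℕ), n ≤ X.card →
      ∃ H ⊆ X, H.card = N ∧ ∃ col, ∀ A ⊆ H, A.card = r → c A = col := by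
  classical
  have := Fintype.ofFinite κ
  induction r generalizing N with
  | zero =>
    refine ⟨N, fun c X hX => ?_⟩
    obtain ⟨H, hH, hc⟩ := Finset.exists_subset_card_eq hX
    exact ⟨H, hH, hc, c ∅, fun A _ hA => by rw [Finset.card_eq_zero.1 hA]⟩
  | succ r ih =>
    -- First pass to a set on which the colour of a set depends on its smallest element only.
    have hmin : ∀ M : ℕ, ∃ n : ℕ, ∀ (c : Finset ℕ → κ) (X : Finset ℕ), n ≤ X.card →
        ∃ Y ⊆ X, Y.card = M ∧ ∃ f : ℕ → κ, ∀ x ∈ Y, ∀ A ⊆ Y, A.card = r →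
          (∀ y ∈ A, x < y) → c (insert x A) = f x := by
      intro M
      induction M with
      | zero =>
        refine ⟨1, fun c X hX => ⟨∅, Finset.empty_subset _, rfl, fun _ => c ∅, ?_⟩⟩
        simp
      | succ M ihM =>
        obtain ⟨n₁, h₁⟩ := ihM
        obtain ⟨n₂, h₂⟩ := ih n₁
        refine ⟨n₂ + 1, fun c X hX => ?_⟩
        have hne : X.Nonempty := Finset.card_pos.1 (by omega)
        set x := X.min' hne with hx
        have hxX : x ∈ X := X.min'_mem hne
        obtain ⟨H, hHX, hHc, col, hcol⟩ := h₂ (fun A => c (insert x A)) (X.erase x)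
          (by rw [Finset.card_erase_of_mem hxX]; omega)
        obtain ⟨Y, hYH, hYc, f, hf⟩ := h₁ c H hHc.ge
        have hlt : ∀ y ∈ Y, x < y := fun y hy =>
          lt_of_le_of_ne (X.min'_le y (Finset.mem_of_mem_erase (hHX (hYH hy))))
            (Finset.ne_of_mem_erase (hHX (hYH hy))).symm
        have hxY : x ∉ Y := fun h => lt_irrefl _ (hlt x h)
        refine ⟨insert x Y, ?_, by rw [Finset.card_insert_of_notMem hxY, hYc],
          Function.update f x col, ?_⟩
        · exact Finset.insert_subset hxX
            ((hYH.trans hHX).trans (Finset.erase_subset _ _))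
        · intro y hy A hA hAc hyA
          have hxA : x ∉ A := by
            intro hxA
            rcases Finset.mem_insert.1 hy with rfl | hy'
            · exact lt_irrefl _ (hyA _ hxA)
            · exact lt_asymm (hlt y hy') (hyA x hxA)
          have hAY : A ⊆ Y := (Finset.subset_insert_iff_of_notMem hxA).1 hA
          rcases Finset.mem_insert.1 hy with rfl | hy'
          · rw [Function.update_self]
            exact hcol A (hAY.trans hYH) hAc
          · rw [Function.update_of_ne (hlt y hy').ne']
            exact hf y hy' A hAY hAc hyA
    obtain ⟨n, hn⟩ := hmin (Fintype.card κ * N + 1)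
    refine ⟨n, fun c X hX => ?_⟩
    obtain ⟨Y, hYX, hYc, f, hf⟩ := hn c X hX
    obtain ⟨col, -, hcol⟩ := Finset.exists_lt_card_fiber_of_mul_lt_card_of_maps_to
      (s := Y) (t := Finset.univ) (f := f) (n := N) (fun _ _ => Finset.mem_univ _)
      (by rw [Finset.card_univ, hYc]; omega)
    obtain ⟨H, hH, hHc⟩ := Finset.exists_subset_card_eq hcol.le
    refine ⟨H, (hH.trans (Finset.filter_subset _ _)).trans hYX, hHc, col, fun A hA hAc => ?_⟩
    have hne : A.Nonempty := Finset.card_pos.1 (by omega)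
    have hmem := A.min'_mem hne
    have hx := Finset.mem_filter.1 (hH (hA hmem))
    have := hf _ hx.1 (A.erase (A.min' hne))
      (((Finset.erase_subset _ _).trans hA).trans (hH.trans (Finset.filter_subset _ _)))
      (by rw [Finset.card_erase_of_mem hmem, hAc]; rfl)
      (fun y hy => Finset.min'_lt_of_mem_erase_min' A hne hy)
    rwa [Finset.insert_erase hmem, hx.2] at this

/-! ### Tournaments given by a set of patterns -/

/-- The ordering of the `r`-set `A` with pattern `π`. -/
def ordering {r : ℕ} {V : Type*} [LinearOrder V] (A : Finset V) (hA : A.card = r)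
    (π : Equiv.Perm (Fin r)) : Fin r ↪ V :=
  π.toEmbedding.trans (A.orderEmbOfFin hA).toEmbedding

lemma ordering_lt_iff {r : ℕ} {V : Type*} [LinearOrder V] (A : Finset V) (hA : A.card = r)
    (π : Equiv.Perm (Fin r)) (i j : Fin r) :
    ordering A hA π i < ordering A hA π j ↔ π i < π j :=
  (A.orderEmbOfFin hA).lt_iff_lt

lemma range_ordering {r : ℕ} {V : Type*} [LinearOrder V] (A : Finset V) (hA : A.card = r)
    (π : Equiv.Perm (Fin r)) : Set.range (ordering A hA π) = A := by
  have : (ordering A hA π : Fin r → V) = A.orderEmbOfFin hA ∘ π := rfl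
  rw [this, π.surjective.range_comp, Finset.range_orderEmbOfFin]

lemma ordering_injective {r : ℕ} {V : Type*} [LinearOrder V] (A : Finset V) (hA : A.card = r) :
    Function.Injective (ordering A hA) := by
  intro π ρ h
  refine perm_eq_of_lt_iff_lt fun i j => ?_
  rw [← ordering_lt_iff A hA π, ← ordering_lt_iff A hA ρ, h]

lemma exists_ordering_eq {r : ℕ} {V : Type*} [LinearOrder V] (A : Finset V) (hA : A.card = r)
    (e : Fin r ↪ V) (he : Set.range e = (A : Set V)) : ∃ π, ordering A hA π = e := by
  have h1 : ∀ i, ∃ j, A.orderEmbOfFin hA j = e i := fun i => by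
    have : e i ∈ Set.range (A.orderEmbOfFin hA) := by
      rw [Finset.range_orderEmbOfFin, ← he]
      exact ⟨i, rfl⟩
    exact this
  choose f hf using h1
  have hinj : Function.Injective f := fun i j h => e.injective (by rw [← hf, ← hf, h])
  refine ⟨Equiv.ofBijective f (Finite.injective_iff_bijective.1 hinj), ?_⟩
  ext i
  exact hf i

open scoped Classical in
/-- The patterns of the edges of `G` within `A` (no pattern if `A` does not have `r` elements). -/
noncomputable def edgePatterns {r : ℕ} {V : Type*} [LinearOrder V] (G : RDigraph r V)
    (A : Finset V) : Finset (Equiv.Perm (Fin r)) :=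
  Finset.univ.filter fun π => ∃ hA : A.card = r, ordering A hA π ∈ G.edges

lemma ncard_edges_eq_card_edgePatterns {r : ℕ} {V : Type*} [LinearOrder V] (G : RDigraph r V)
    {A : Finset V} (hA : A.card = r) :
    {e : Fin r ↪ V | e ∈ G.edges ∧ Set.range e = (A : Set V)}.ncard
      = (edgePatterns G A).card := by
  have : {e : Fin r ↪ V | e ∈ G.edges ∧ Set.range e = (A : Set V)}
      = ordering A hA '' (edgePatterns G A : Set (Equiv.Perm (Fin r))) := by
    ext e
    simp only [Set.mem_ofPred_eq, Set.mem_image, edgePatterns, Finset.coe_filter,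
      Finset.mem_univ, true_and]
    constructor
    · rintro ⟨he, hr⟩
      obtain ⟨π, rfl⟩ := exists_ordering_eq A hA e hr
      exact ⟨π, ⟨hA, he⟩, rfl⟩
    · rintro ⟨π, hπ, rfl⟩
      exact ⟨hπ.2, range_ordering A hA π⟩
  rw [this, Set.ncard_image_of_injective _ (ordering_injective A hA), Set.ncard_coe_finset]

/-- The `r`-digraph whose edges are the lists with pattern in `T`. -/
def patternDigraph {r : ℕ} (T : Finset (Equiv.Perm (Fin r))) (V : Type*) [LinearOrder V] :
    RDigraph r V where
  edges := {e | ∃ π ∈ T, ∀ i j, e i < e j ↔ π i < π j}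

lemma patternDigraph_isTournament {r : ℕ} (T : Finset (Equiv.Perm (Fin r))) (V : Type*)
    [LinearOrder V] : (patternDigraph T V).IsTournament T.card := by
  intro A hA
  rw [ncard_edges_eq_card_edgePatterns _ hA]
  congr 1
  ext π
  simp only [edgePatterns, patternDigraph, Set.mem_ofPred_eq, Finset.mem_filter, Finset.mem_univ,
    true_and, ordering_lt_iff]
  constructor
  · rintro ⟨-, ρ, hρ, h⟩
    rwa [perm_eq_of_lt_iff_lt h]
  · exact fun h => ⟨hA, π, h, fun _ _ => Iff.rfl⟩

lemma exists_isTournament {r k : ℕ} (hk : k ≤ r !) (n : ℕ) :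
    ∃ G : RDigraph r (Fin n), G.IsTournament k := by
  obtain ⟨T, -, hT⟩ := Finset.exists_subset_card_eq
    (s := (Finset.univ : Finset (Equiv.Perm (Fin r)))) (n := k)
    (by rw [Finset.card_univ, Fintype.card_perm, Fintype.card_fin]; exact hk)
  exact ⟨patternDigraph T (Fin n), hT ▸ patternDigraph_isTournament T (Fin n)⟩

/-- The interval of length `r` starting at `j`, an edge of the tight path on `s` vertices. -/
def interval {r s j : ℕ} (h : j + r ≤ s) : Fin r ↪ Fin s :=
  ⟨fun i => ⟨j + i.1, by omega⟩, fun i i' h => by simpa [Fin.ext_iff] using h⟩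

lemma interval_mem_edges {r s j : ℕ} (h : j + r ≤ s) : interval h ∈ (tightPath r s).edges :=
  ⟨j, fun _ => rfl⟩

/-! ### Walks within an acyclic set of patterns are short -/

lemma exists_isDirectedCycle_of_walk {V : Type*} {G : Digraph V} (u : ℕ → V) (N : ℕ)
    (hu : ∀ i < N, G.Adj (u i) (u (i + 1))) {i j : ℕ} (hij : i < j) (hj : j ≤ N)
    (h : u i = u j) :
    ∃ (m : ℕ) (v : Fin (m + 1) → V), IsDirectedCycle G v ∧ ∀ p, ∃ q < N, v p = u q := by
  classical
  -- A closed subwalk of minimal length has distinct vertices.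
  have hex : ∃ d, ∃ i, 0 < d ∧ i + d ≤ N ∧ u i = u (i + d) :=
    ⟨j - i, i, by omega, by omega, by rw [h]; congr 1; omega⟩
  obtain ⟨i, hd, hiN, hclose⟩ := Nat.find_spec hex
  set d := Nat.find hex with hdef
  have hmin : ∀ d' < d, ∀ i', 0 < d' → i' + d' ≤ N → u i' ≠ u (i' + d') := by
    intro d' hd' i' h1 h2 h3
    exact Nat.find_min hex hd' ⟨i', h1, h2, h3⟩
  obtain ⟨m, hm⟩ : ∃ m, d = m + 1 := ⟨d - 1, by omega⟩
  refine ⟨m, fun p => u (i + p.1), ⟨?_, ?_⟩, fun p => ⟨i + p.1, by have := p.2; omega, rfl⟩⟩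
  · have hlt : ∀ p q : Fin (m + 1), p.1 < q.1 → u (i + p.1) ≠ u (i + q.1) := by
      intro p q hpq
      have := hmin (q.1 - p.1) (by have := q.2; omega) (i + p.1) (by omega)
        (by have := q.2; omega)
      rwa [show i + p.1 + (q.1 - p.1) = i + q.1 by omega] at this
    intro p q hpq
    rcases lt_trichotomy p.1 q.1 with h | h | h
    · exact absurd hpq (hlt p q h)
    · exact Fin.ext h
    · exact absurd hpq.symm (hlt q p h)
  · intro p
    induction p using Fin.lastCases with
    | last =>
      have := hu (i + m) (by omega)
      rw [show i + m + 1 = i + d by omega, ← hclose] at this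
      simpa using this
    | cast p =>
      have := hu (i + p.1) (by have := p.2; omega)
      simpa [Fin.val_add_one_of_lt (Fin.castSucc_lt_last p), add_assoc] using this

lemma InducesAcyclic.walk_length_lt {V : Type*} {G : Digraph V} {T : Finset V}
    (hT : InducesAcyclic G T) (u : ℕ → V) (N : ℕ) (hu : ∀ i < N, G.Adj (u i) (u (i + 1)))
    (hmem : ∀ i ≤ N, u i ∈ T) : N < T.card := by
  by_contra hN
  obtain ⟨i, hi, j, hj, hij, h⟩ := Finset.exists_ne_map_eq_of_card_lt_of_maps_to
    (s := Finset.range (N + 1)) (t := T) (f := u) (by rw [Finset.card_range]; omega)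
    (fun i hi => hmem i (by have := Finset.mem_range.1 hi; omega))
  rw [Finset.mem_range] at hi hj
  have key : ∃ (m : ℕ) (v : Fin (m + 1) → V), IsDirectedCycle G v ∧
      ∀ p, ∃ q < N, v p = u q := by
    rcases Nat.lt_or_gt_of_ne hij with h' | h'
    · exact exists_isDirectedCycle_of_walk u N hu h' (by omega) h
    · exact exists_isDirectedCycle_of_walk u N hu h' (by omega) h.symm
  obtain ⟨m, v, hv, hvu⟩ := key
  refine hT m v hv fun p => ?_
  obtain ⟨q, hq, h⟩ := hvu p
  rw [h]
  exact hmem q hq.le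

/-- The consecutive windows of a tight path in `patternDigraph T` form a walk within `T`. -/
lemma length_le_of_isSubgraphOf {r s : ℕ} {T : Finset (Equiv.Perm (Fin r))}
    (hT : InducesAcyclic (PSG r) T) {V : Type*} [LinearOrder V]
    (h : (tightPath r s).IsSubgraphOf (patternDigraph T V)) : s ≤ r + T.card := by
  by_contra hs
  obtain ⟨f, hf⟩ := h
  have h1 : ∀ j, ∃ π : Equiv.Perm (Fin r), ∀ hj : j + r ≤ s, π ∈ T ∧
      ∀ i i' : Fin r, f ⟨j + i.1, by omega⟩ < f ⟨j + i'.1, by omega⟩ ↔ π i < π i' := by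
    intro j
    by_cases hj : j + r ≤ s
    · obtain ⟨π, hπ, h2⟩ := hf _ (interval_mem_edges hj)
      exact ⟨π, fun _ => ⟨hπ, h2⟩⟩
    · exact ⟨1, fun h => absurd h hj⟩
  choose u hu using h1
  have := hT.walk_length_lt u (s - r) (fun j hj i i' _ => ?_) (fun j hj => (hu j (by omega)).1)
  · omega
  · have e1 := (hu j (by omega)).2 ⟨i.1 + 1, by omega⟩ ⟨i'.1 + 1, by omega⟩
    have e2 := (hu (j + 1) (by omega)).2 ⟨i.1, by omega⟩ ⟨i'.1, by omega⟩
    simp only [suffix, initial]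
    rw [← e1, ← e2]
    simp only [add_comm, add_left_comm]

lemma InducesAcyclic.subset {V : Type*} {G : Digraph V} {S T : Finset V}
    (hT : InducesAcyclic G T) (h : S ⊆ T) : InducesAcyclic G S :=
  fun m v hv hS => hT m v hv fun i => h (hS i)

theorem not_tendsto_pathNumber {r k : ℕ} (hk : k ≤ acyclicNumber (PSG r)) :
    ¬ Tendsto (fun n => pathNumber n r k) atTop atTop := by
  intro h
  obtain ⟨T, hT, hcard⟩ := exists_card_eq_acyclicNumber (PSG r)
  obtain ⟨S, hS, rfl⟩ := Finset.exists_subset_card_eq (hcard ▸ hk)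
  obtain ⟨n, hn⟩ := (h.eventually_gt_atTop (r + S.card)).exists
  refine hn.not_ge (csSup_le' fun s hs => ?_)
  exact length_le_of_isSubgraphOf (hT.subset hS) (hs _ (patternDigraph_isTournament S (Fin n)))

/-! ### Long tight paths from a directed cycle of patterns -/

/-- A walk in the pattern-shift graph is the sequence of patterns of the consecutive windows of
a sequence of distinct rationals. -/
lemma exists_realization {r : ℕ} (hr : 1 ≤ r) (u : ℕ → Equiv.Perm (Fin r))
    (hu : ∀ i, (PSG r).Adj (u i) (u (i + 1))) (N : ℕ) :
    ∃ x : ℕ → ℚ, (∀ i < r + N, ∀ j < r + N, x i = x j → i = j) ∧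
      ∀ j ≤ N, ∀ p q : Fin r, x (j + p.1) < x (j + q.1) ↔ u j p < u j q := by
  classical
  induction N with
  | zero =>
    refine ⟨fun i => if h : i < r then ((u 0 ⟨i, h⟩).1 : ℚ) else 0, fun i hi j hj h => ?_,
      fun j hj p q => ?_⟩
    · rw [add_zero] at hi hj
      simp only [hi, hj, dif_pos, Nat.cast_inj] at h
      simpa using (u 0).injective (Fin.ext h)
    · obtain rfl : j = 0 := by omega
      simp
  | succ N ih =>
    obtain ⟨x, hinj, hx⟩ := ih
    let last : Fin r := ⟨r - 1, by omega⟩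
    have hlast : ∀ p : Fin r, p ≠ last → p.1 + 1 < r := by
      intro p hp
      have h1 : p.1 ≠ r - 1 := fun h => hp (Fin.ext h)
      have := p.2
      omega
    have hold : ∀ p q : Fin r, p ≠ last → q ≠ last →
        (x (N + 1 + p.1) < x (N + 1 + q.1) ↔ u (N + 1) p < u (N + 1) q) := by
      intro p q hp hq
      have h1 := hx N le_rfl ⟨p.1 + 1, hlast p hp⟩ ⟨q.1 + 1, hlast q hq⟩
      rw [lt_iff_lt_of_adj (hu N)] at h1
      rw [← h1, show N + 1 + p.1 = N + (p.1 + 1) by ring, show N + 1 + q.1 = N + (q.1 + 1) by ring]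
    -- The new term has to lie in the gap prescribed by the next pattern, off all previous terms.
    obtain ⟨y, hynew, hylo, hyhi⟩ : ∃ y : ℚ, (∀ i < r + N, x i ≠ y) ∧
        (∀ p, u (N + 1) p < u (N + 1) last → x (N + 1 + p.1) < y) ∧
        (∀ p, u (N + 1) last < u (N + 1) p → y < x (N + 1 + p.1)) := by
      let lo : Finset ℚ := (Finset.univ.filter fun p => u (N + 1) p < u (N + 1) last).image
        fun p => x (N + 1 + p.1)
      let hi : Finset ℚ := (Finset.univ.filter fun p => u (N + 1) last < u (N + 1) p).image
        fun p => x (N + 1 + p.1)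
      obtain ⟨a, ha1, ha2⟩ := Order.exists_between_finsets lo hi (by
        intro a ha b hb
        obtain ⟨p, hp, rfl⟩ := Finset.mem_image.1 ha
        obtain ⟨q, hq, rfl⟩ := Finset.mem_image.1 hb
        simp only [Finset.mem_filter, Finset.mem_univ, true_and] at hp hq
        exact (hold p q (by rintro rfl; exact hp.ne rfl) (by rintro rfl; exact hq.ne rfl)).2
          (hp.trans hq))
      obtain ⟨b, hb1, hb2⟩ := Order.exists_between_finsets {a} hi (by
        intro c hc d hd
        rw [Finset.mem_singleton.1 hc]
        exact ha2 d hd)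
      have hab : a < b := hb1 a (Finset.mem_singleton_self a)
      obtain ⟨y, hy, hynot⟩ := (Set.Ioo_infinite hab).exists_notMem_finset
        ((Finset.range (r + N)).image x)
      refine ⟨y, fun i hi h => hynot (Finset.mem_image.2 ⟨i, Finset.mem_range.2 hi, h⟩),
        fun p hp => ?_, fun p hp => ?_⟩
      · exact (ha1 _ (Finset.mem_image.2 ⟨p, by simpa using hp, rfl⟩)).trans hy.1
      · exact hy.2.trans (hb2 _ (Finset.mem_image.2 ⟨p, by simpa using hp, rfl⟩))
    have hup : ∀ i, i < r + N → Function.update x (r + N) y i = x i := fun i hi =>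
      Function.update_of_ne hi.ne _ _
    have hnew : Function.update x (r + N) y (r + N) = y := Function.update_self _ _ _
    refine ⟨Function.update x (r + N) y, fun i hi j hj h => ?_, fun j hj p q => ?_⟩
    · rcases Nat.lt_or_ge i (r + N) with h1 | h1 <;> rcases Nat.lt_or_ge j (r + N) with h2 | h2
      · rw [hup i h1, hup j h2] at h
        exact hinj i h1 j h2 h
      · obtain rfl : j = r + N := by omega
        rw [hup i h1, hnew] at h
        exact absurd h (hynew i h1)
      · obtain rfl : i = r + N := by omega
        rw [hup j h2, hnew] at h
        exact absurd h.symm (hynew j h2)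
      · omega
    · have hp := p.2
      have hq := q.2
      rcases Nat.lt_or_ge j (N + 1) with hjN | hjN
      · rw [hup _ (by omega), hup _ (by omega)]
        exact hx j (by omega) p q
      · obtain rfl : j = N + 1 := by omega
        have hl : N + 1 + last.1 = r + N := by
          simp only [last]
          omega
        have hne : ∀ p, p ≠ last → u (N + 1) p ≠ u (N + 1) last := fun p hp h =>
          hp ((u (N + 1)).injective h)
        by_cases h1 : p = last <;> by_cases h2 : q = last
        · simp [h1, h2]
        · have := hlast q h2
          rw [h1, hl, hnew, hup _ (by omega)]
          refine ⟨fun h => ?_, hyhi q⟩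
          exact (hne q h2).lt_or_gt.resolve_left fun h' => lt_asymm h (hylo q h')
        · have := hlast p h1
          rw [h2, hl, hnew, hup _ (by omega)]
          refine ⟨fun h => ?_, hylo p⟩
          exact (hne p h1).lt_or_gt.resolve_right fun h' => lt_asymm h (hyhi p h')
        · have := hlast p h1
          have := hlast q h2
          rw [hup _ (by omega), hup _ (by omega)]
          exact hold p q h1 h2

/-- If all `r`-subsets of `H` have the same set `T` of edge patterns and `T` contains a directed
cycle, then `G` contains the tight path on `H.card` vertices: go around the cycle. -/
lemma isSubgraphOf_of_homogeneous {r : ℕ} (hr : 1 ≤ r) {V : Type*} [LinearOrder V]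
    (G : RDigraph r V) {T : Finset (Equiv.Perm (Fin r))} (hT : ¬ InducesAcyclic (PSG r) T)
    {N : ℕ} {H : Finset V} (hH : H.card = r + N)
    (hhom : ∀ A ⊆ H, A.card = r → edgePatterns G A = T) :
    (tightPath r (r + N)).IsSubgraphOf G := by
  classical
  unfold InducesAcyclic at hT
  push Not at hT
  obtain ⟨m, v, hv, hvT⟩ := hT
  obtain ⟨x, hinj, hx⟩ := exists_realization hr (fun i => v (Fin.ofNat (m + 1) i)) (fun i => by
    have := hv.2 (Fin.ofNat (m + 1) i)
    convert this using 2
    ext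
    simp [Fin.val_add, Fin.ofNat]) N
  -- Transport the realising sequence to `H` in an order preserving way.
  let X : Finset ℚ := Finset.univ.image fun i : Fin (r + N) => x i.1
  have hX : X.card = r + N := by
    rw [Finset.card_image_of_injective, Finset.card_univ, Fintype.card_fin]
    exact fun i j h => Fin.ext (hinj _ i.2 _ j.2 h)
  let rank : Fin (r + N) → Fin (r + N) := fun i =>
    (X.orderIsoOfFin hX).symm ⟨x i.1, Finset.mem_image.2 ⟨i, Finset.mem_univ _, rfl⟩⟩
  have hrank : ∀ i j, rank i < rank j ↔ x i.1 < x j.1 := fun i j =>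
    (X.orderIsoOfFin hX).symm.lt_iff_lt.trans Iff.rfl
  have hrinj : Function.Injective rank := fun i j h => by
    have := (X.orderIsoOfFin hX).symm.injective h
    exact Fin.ext (hinj _ i.2 _ j.2 (Subtype.ext_iff.1 this))
  let h : Fin (r + N) ↪ V := ⟨fun i => H.orderEmbOfFin hH (rank i),
    fun i j e => hrinj ((H.orderEmbOfFin hH).injective e)⟩
  have hlt : ∀ i j, h i < h j ↔ x i.1 < x j.1 := fun i j =>
    (H.orderEmbOfFin hH).lt_iff_lt.trans (hrank i j)
  refine ⟨h, ?_⟩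
  rintro e ⟨j, he⟩
  have hjN : j ≤ N := by
    have h1 := he ⟨r - 1, by omega⟩
    have h2 := (e ⟨r - 1, by omega⟩).2
    simp only at h1
    omega
  let A : Finset V := Finset.univ.map (e.trans h)
  have hA : A.card = r := by simp [A]
  have hAH : A ⊆ H := by
    intro a ha
    obtain ⟨i, -, rfl⟩ := Finset.mem_map.1 ha
    exact H.orderEmbOfFin_mem hH _
  obtain ⟨π, hπ⟩ := exists_ordering_eq A hA (e.trans h)
    (by rw [Finset.coe_map, Finset.coe_univ, Set.image_univ])
  have hπv : π = v (Fin.ofNat (m + 1) j) := by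
    refine perm_eq_of_lt_iff_lt fun p q => ?_
    rw [← ordering_lt_iff A hA, hπ, ← hx j hjN p q, ← he p, ← he q]
    exact hlt _ _
  have hmem : π ∈ edgePatterns G A := by
    rw [hhom A hAH hA, hπv]
    exact hvT _
  simp only [edgePatterns, Finset.mem_filter, Finset.mem_univ, true_and] at hmem
  rw [← hπ]
  exact hmem.2

theorem tendsto_pathNumber {r k : ℕ} (hr : 1 ≤ r) (hk : acyclicNumber (PSG r) < k)
    (hkr : k ≤ r !) : Tendsto (fun n => pathNumber n r k) atTop atTop := by
  rw [tendsto_atTop_atTop]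
  intro N
  obtain ⟨n₀, hn₀⟩ := exists_monochromatic_finset (κ := Finset (Equiv.Perm (Fin r))) r (r + N)
  refine ⟨n₀, fun n hn => ?_⟩
  have hbdd : BddAbove {s : ℕ | ∀ G : RDigraph r (Fin n), G.IsTournament k →
      (tightPath r s).IsSubgraphOf G} := by
    refine ⟨n, fun s hs => ?_⟩
    obtain ⟨G, hG⟩ := exists_isTournament hkr n
    obtain ⟨h, -⟩ := hs G hG
    simpa using Fintype.card_le_of_embedding h
  refine le_trans (Nat.le_add_left N r) (le_csSup hbdd fun G hG => ?_)
  -- Colour the sets of vertices by their sets of edge patterns.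
  obtain ⟨H, hHn, hHc, T, hT⟩ := hn₀
    (fun A => edgePatterns G (Finset.univ.filter fun i : Fin n => i.1 ∈ A)) (Finset.range n)
    (by rw [Finset.card_range]; exact hn)
  have hcard : ∀ A ⊆ Finset.range n,
      (Finset.univ.filter fun i : Fin n => i.1 ∈ A).card = A.card := by
    intro A hA
    rw [← Finset.card_map Fin.valEmbedding]
    congr 1
    ext i
    simp only [Finset.mem_map, Finset.mem_filter, Finset.mem_univ, true_and,
      Fin.valEmbedding_apply]
    refine ⟨?_, fun hi => ⟨⟨i, Finset.mem_range.1 (hA hi)⟩, hi, rfl⟩⟩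
    rintro ⟨i, hi, rfl⟩
    exact hi
  have hhom : ∀ A ⊆ Finset.univ.filter fun i : Fin n => i.1 ∈ H, A.card = r →
      edgePatterns G A = T := by
    intro A hA hAr
    rw [← hT (A.map Fin.valEmbedding) ?_ (by rw [Finset.card_map, hAr])]
    · congr 1
      ext i
      simp [Fin.val_inj]
    · intro i hi
      obtain ⟨i', hi', rfl⟩ := Finset.mem_map.1 hi
      exact (Finset.mem_filter.1 (hA hi')).2
  have hHcard := (hcard H hHn).trans hHc
  refine isSubgraphOf_of_homogeneous hr G (T := T) (fun hac => ?_) hHcard hhom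
  obtain ⟨A, hA, hAr⟩ := Finset.exists_subset_card_eq
    (s := Finset.univ.filter fun i : Fin n => i.1 ∈ H) (n := r) (by omega)
  have h1 := ncard_edges_eq_card_edgePatterns G hAr
  rw [hG A hAr, hhom A hA hAr] at h1
  have := hac.card_le_acyclicNumber
  omega

/-- The threshold for growing paths is the acyclic number of the pattern-shift graph plus one. -/
theorem isGrowingPathThreshold {r : ℕ} (hr : 2 ≤ r) :
    IsGrowingPathThreshold r (acyclicNumber (PSG r) + 1) := by
  have h1 := acyclicNumber_PSG_add_le hr
  have h2 := Nat.factorial_pos (r - 1)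
  refine ⟨⟨by omega, tendsto_pathNumber (by omega) (Nat.lt_succ_self _) (by omega)⟩, ?_⟩
  rintro k ⟨-, hk⟩
  by_contra h
  exact not_tendsto_pathNumber (by omega) hk

/-! ### The explicit bounds -/

lemma one_le_log_div_log_log {r : ℕ} (hr : 3 ≤ r) :
    1 ≤ Real.log r / Real.log (Real.log r) := by
  have hr3 : (3 : ℝ) ≤ r := by exact_mod_cast hr
  have h1 : 1 < Real.log r := by
    rw [Real.lt_log_iff_exp_lt (by linarith)]
    linarith [Real.exp_one_lt_d9]
  rw [one_le_div (Real.log_pos h1)]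
  linarith [Real.log_le_sub_one_of_pos (show 0 < Real.log r by linarith)]

lemma acyclicNumber_PSG_div_le {r : ℕ} (hr : 2 ≤ r) :
    (acyclicNumber (PSG r) : ℝ) / (r ! : ℝ)
      ≤ 1 - 1 / (r : ℝ) - (Nat.totient r : ℝ) / (r ! : ℝ) := by
  have h : (acyclicNumber (PSG r) : ℝ) + ((r - 1)! : ℝ) + (Nat.totient r : ℝ) ≤ (r ! : ℝ) := by
    exact_mod_cast acyclicNumber_PSG_add_le hr
  have hf : (0 : ℝ) < (r ! : ℝ) := by positivity
  have hrpos : (0 : ℝ) < r := by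
    have : 0 < r := by omega
    exact_mod_cast this
  have hfac : (r ! : ℝ) = r * ((r - 1)! : ℝ) := by
    exact_mod_cast (Nat.mul_factorial_pred (by omega)).symm
  have h1 : 1 / (r : ℝ) = ((r - 1)! : ℝ) / (r ! : ℝ) := by
    rw [hfac]
    field_simp
  rw [h1, div_le_iff₀ hf, sub_mul, sub_mul, div_mul_cancel₀ _ hf.ne', div_mul_cancel₀ _ hf.ne']
  linarith

theorem exists_forall_le_acyclicNumber_div_log :
    ∃ C : ℝ, 0 < C ∧ ∀ r : ℕ, 3 ≤ r →
      1 - 1 / (r : ℝ) - C * (Real.log r / ((r : ℝ) ^ 2 * Real.log (Real.log r)))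
        ≤ (acyclicNumber (PSG r) : ℝ) / (r ! : ℝ) := by
  obtain ⟨r₀, hr₀⟩ := exists_forall_le_acyclicNumber_div
  -- For `r < r₀` this choice of `C` makes the left-hand side negative.
  refine ⟨(r₀ : ℝ) ^ 2 + 2, by positivity, fun r hr => ?_⟩
  have hrpos : (0 : ℝ) < r := by
    have : 0 < r := by omega
    exact_mod_cast this
  have hC : ((r₀ : ℝ) ^ 2 + 2) / (r : ℝ) ^ 2
      ≤ ((r₀ : ℝ) ^ 2 + 2) * (Real.log r / ((r : ℝ) ^ 2 * Real.log (Real.log r))) := by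
    have h1 := mul_le_mul_of_nonneg_left (one_le_log_div_log_log hr)
      (show 0 ≤ ((r₀ : ℝ) ^ 2 + 2) / (r : ℝ) ^ 2 by positivity)
    rw [mul_one] at h1
    refine h1.trans_eq ?_
    rw [div_mul_div_comm, mul_div_assoc]
  rcases Nat.lt_or_ge r r₀ with h | h
  · have h1 : 1 ≤ ((r₀ : ℝ) ^ 2 + 2) / (r : ℝ) ^ 2 := by
      rw [one_le_div (by positivity)]
      have h2 : (r : ℝ) ^ 2 ≤ (r₀ : ℝ) ^ 2 := by
        have : (r : ℝ) ≤ r₀ := by exact_mod_cast h.le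
        gcongr
      linarith
    have h2 : 0 ≤ 1 / (r : ℝ) := by positivity
    have h3 : 0 ≤ (acyclicNumber (PSG r) : ℝ) / (r ! : ℝ) := by positivity
    linarith
  · have h1 := hr₀ r h
    have h2 : 2 / (r : ℝ) ^ 2 ≤ ((r₀ : ℝ) ^ 2 + 2) / (r : ℝ) ^ 2 := by
      gcongr
      have : 0 ≤ (r₀ : ℝ) ^ 2 := by positivity
      linarith
    linarith

end GrowingPaths

theorem mainTheorem3 :
    ∃ C : ℝ, 0 < C ∧ ∀ r : ℕ, 3 ≤ r →
      (1 - 1 / (r : ℝ) - C * (Real.log r / ((r : ℝ) ^ 2 * Real.log (Real.log r)))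
          ≤ (GrowingPaths.acyclicNumber (GrowingPaths.PSG r) : ℝ) / (r ! : ℝ) ∧
        (GrowingPaths.acyclicNumber (GrowingPaths.PSG r) : ℝ) / (r ! : ℝ)
          ≤ 1 - 1 / (r : ℝ) - (Nat.totient r : ℝ) / (r ! : ℝ)) ∧
      ∃ k : ℕ, GrowingPaths.IsGrowingPathThreshold r k ∧
        (1 - 1 / (r : ℝ) - C * (Real.log r / ((r : ℝ) ^ 2 * Real.log (Real.log r)))) * (r ! : ℝ)
          ≤ (k : ℝ) ∧
        (k : ℝ) ≤ (1 - 1 / (r : ℝ) - ((Nat.totient r : ℝ) - 1) / (r ! : ℝ)) * (r ! : ℝ) := by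
  obtain ⟨C, hC, h⟩ := GrowingPaths.exists_forall_le_acyclicNumber_div_log
  refine ⟨C, hC, fun r hr => ?_⟩
  have hlow := h r hr
  have hup := GrowingPaths.acyclicNumber_PSG_div_le (show 2 ≤ r by omega)
  have hf : (0 : ℝ) < (r ! : ℝ) := by positivity
  refine ⟨⟨hlow, hup⟩, _, GrowingPaths.isGrowingPathThreshold (by omega), ?_, ?_⟩
  · rw [le_div_iff₀ hf] at hlow
    push_cast
    linarith
  · rw [div_le_iff₀ hf, sub_mul, div_mul_cancel₀ _ hf.ne'] at hup
    rw [sub_mul _ _ (r ! : ℝ), div_mul_cancel₀ _ hf.ne']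
    push_cast
    linarith
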